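/- **Definitions.** For integers $0\le k\le n$, a $(k,n)$-diagram $\mathcal D$ is a left-justified diagram of boxes in a $k\times(n-k)$ rectangle with row lengths $\lambda_1\ge\dots\ge\lambda_k\ge 0$ (empty rows and columns are allowed); $n$ is its length. Its border edges are the $n$ unit steps of its South-East border, the lattice path from the North-East to the South-West corner of the rectangle. The shifted diagram $\mathcal D^*$ is obtained by adding above $\mathcal D$ a staircase of boxes, with $n-k+1-j$ additional boxes on top of column $j$ for $1\le j\le n-k$; the topmost box of each column is called diagonal, and the length and the border edges of $\mathcal D^*$ are those of $\mathcal D$. A corner of $\mathcal D$ (or of $\mathcal D^*$) is a cell whose bottom and right edges are border edges. The corners of a tableau are those of its underlying diagram, and for a finite set $X$ of tableaux $c(X)$ denotes the total number of corners of the tableaux in $X$. * A type $B$ permutation tableau of length $n$ is a filling with $0$s and $1$s of a shifted diagram $\mathcal D^*$ of length $n$ such that each column has at least one $1$; no $0$ has both a $1$ above it in its column and a $1$ to its left in its row; and no $0$ in a diagonal cell has a $1$ to its left in its row. The set of these is $\mathcal{PT}^B_n$. * An alternative tableau of length $m$ is a partial filling of the cells of a $(k,m)$-diagram (for some $k$)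 with arrows $\leftarrow$ and $\uparrow$ such that all cells to the left of a $\leftarrow$ in its row and all cells above a $\uparrow$ in its column are empty. It is symmetric if it is unchanged by the reflection in its main diagonal (which exchanges rows with columns and $\leftarrow$ with $\uparrow$). The set of symmetric alternative tableaux of length $2n$ is $\mathcal{AT}^{sym}_{2n}$. * A tree-like tableau of size $m$ is a placement of $m$ points in cells of a diagram without empty rows or columns such that the top left cell contains a point; every other pointed cell has either a pointed cell above it in its column or a pointed cell to its left in its row, but not both; and every row and every column contains a pointed cell. It is symmetric if it is unchanged by the reflection in its main diagonal. The set of symmetric tree-like tableaux of size $2n+1$ is $\mathcal T^{sym}_{2n+1}$. **Theorem.** For every integer $n\ge 1$ the sets $\mathcal{PT}^B_n$, $\mathcal{AT}^{sym}_{2n}$ and $\mathcal T^{sym}_{2n+1}$ are finite, and $$c(\mathcal{PT}_n^B)=\begin{cases}0,& n=1,\\ 2^{n-1}(n-1)!\cdot\frac{4n^2+7n-12}{12},& n\ge 2,\end{cases}$$ $$c(\mathcal{AT}_{2n}^{sym})=\begin{cases}1,& n=1,\\ 2^{n}(n-1)!\cdot\frac{4n^2+13n-12}{12},& n\ge 2,\end{cases}$$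 $$c(\mathcal{T}_{2n+1}^{sym})=\begin{cases}3,& n=1,\\ 2^{n}\,n!\cdot\frac{4n+13}{12},& n\ge 2.\end{cases}$$ -/

import Mathlib

namespace CornerCount

/-- A `(k, n)`-diagram: a left-justified diagram of boxes inside a `k × (n - k)` rectangle, where
`k = rows` and `n - k = cols`. Empty rows and empty columns are allowed. The cell `(i, j)` lies in
row `i` (from the top) and column `j` (from the left), both counted from `0`. -/
@[ext]
structure Diagram where
  /-- the boxes -/
  shape : YoungDiagram
  /-- the number `k` of rows of the rectangle -/
  rows : ℕ
  /-- the number `n - k` of columns of the rectangle -/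
  cols : ℕ
  colLen_le : shape.colLen 0 ≤ rows
  rowLen_le : shape.rowLen 0 ≤ cols

namespace Diagram

/-- The length `n` of a `(k, n)`-diagram. -/
def length (D : Diagram) : ℕ := D.rows + D.cols

/-- The reflection in the main diagonal. -/
def reflect (D : Diagram) : Diagram where
  shape := D.shape.transpose
  rows := D.cols
  cols := D.rows
  colLen_le := by simpa using D.rowLen_le
  rowLen_le := by simpa using D.colLen_le

/-- The South-East border is the lattice path from the North-East to the South-West corner of the
rectangle that follows the boxes. Its vertical steps: in each row `y < rows` there is one, on
the vertical line with `x` columns to its left, where `x` is the length of that row. -/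
def IsVerticalBorderEdge (D : Diagram) (y x : ℕ) : Prop :=
  y < D.rows ∧ x = D.shape.rowLen y

/-- The horizontal steps of the South-East border: in each column `x < cols` there is one, on the
horizontal line with `y` rows above it, where `y` is the length of that column. -/
def IsHorizontalBorderEdge (D : Diagram) (y x : ℕ) : Prop :=
  x < D.cols ∧ y = D.shape.colLen x

/-- A corner of a diagram: a cell whose right and bottom edges are border edges. -/
def IsCorner (D : Diagram) (c : ℕ × ℕ) : Prop :=
  c ∈ D.shape ∧ D.IsVerticalBorderEdge c.1 (c.2 + 1) ∧ D.IsHorizontalBorderEdge (c.1 + 1) c.2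

/-- The cells of the shifted diagram `D*`. Above the `rows` rows of `D` there are `cols` added
rows, so that row `i` of `D` becomes row `cols + i` of `D*`; the added row `r < cols` consists of
the cells `(r, 0), …, (r, r)`. Thus column `j` gets `cols - j` additional boxes, and the topmost
of them, its diagonal cell, is `(j, j)`. -/
def shiftedCells (D : Diagram) : Set (ℕ × ℕ) :=
  {c | (c.1 < D.cols ∧ c.2 ≤ c.1) ∨ ∃ i, c.1 = D.cols + i ∧ (i, c.2) ∈ D.shape}

/-- A corner of the shifted diagram `D*`: a cell whose right and bottom edges are border edges,
the border edges of `D*` being those of `D` (moved down by `cols` rows). -/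
def IsShiftedCorner (D : Diagram) (c : ℕ × ℕ) : Prop :=
  c ∈ D.shiftedCells ∧
    (∃ y, c.1 = D.cols + y ∧ D.IsVerticalBorderEdge y (c.2 + 1)) ∧
    (∃ y, c.1 + 1 = D.cols + y ∧ D.IsHorizontalBorderEdge y c.2)

end Diagram

/-- A type `B` permutation tableau: a `0,1`-filling of a shifted diagram `D*`, given by the set
`ones` of the cells that contain a `1` (every other cell of `D*` contains a `0`). -/
@[ext]
structure TypeBPermutationTableau where
  /-- the diagram `D` -/
  diagram : Diagram
  /-- the cells of `D*` filled with `1` -/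
  ones : Finset (ℕ × ℕ)
  ones_subset : ∀ c ∈ ones, c ∈ diagram.shiftedCells
  /-- each column has at least one `1` -/
  exists_one : ∀ j < diagram.cols, ∃ r, (r, j) ∈ ones
  /-- no `0` has both a `1` above it in its column and a `1` to its left in its row -/
  zero_condition : ∀ r j, (r, j) ∈ diagram.shiftedCells → (r, j) ∉ ones →
    ¬ ((∃ r' < r, (r', j) ∈ ones) ∧ (∃ j' < j, (r, j') ∈ ones))
  /-- a `0` in a diagonal cell has no `1` to its left in its row -/
  diagonal_condition : ∀ j < diagram.cols, (j, j) ∉ ones → ∀ j' < j, (j, j') ∉ ones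

/-- The type `B` permutation tableaux of length `n`. -/
def typeBPermutationTableaux (n : ℕ) : Set TypeBPermutationTableau :=
  {T | T.diagram.length = n}

/-- The two symbols of alternative tableaux. -/
inductive Arrow where
  | left
  | up

/-- The reflection in the main diagonal exchanges left arrows and up arrows. -/
def Arrow.reflect : Arrow → Arrow
  | left => up
  | up => left

/-- An alternative tableau: a partial filling of a diagram with left arrows and up arrows such
that all cells to the left of a left arrow and all cells above an up arrow are empty
(`entry c = none` for an empty cell, and for all positions outside of the diagram). -/
@[ext]
structure AlternativeTableau where
  /-- the underlying diagram -/
  diagram : Diagram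
  /-- the partial filling -/
  entry : ℕ × ℕ → Option Arrow
  entry_eq_none : ∀ c, c ∉ diagram.shape → entry c = none
  left_condition : ∀ i j, entry (i, j) = some Arrow.left → ∀ j' < j, entry (i, j') = none
  up_condition : ∀ i j, entry (i, j) = some Arrow.up → ∀ i' < i, entry (i', j) = none

/-- An alternative tableau is symmetric if it is unchanged by the reflection in its main
diagonal. -/
def AlternativeTableau.IsSymmetric (T : AlternativeTableau) : Prop :=
  T.diagram.reflect = T.diagram ∧
    ∀ i j, T.entry (j, i) = (T.entry (i, j)).map Arrow.reflect

/-- The symmetric alternative tableaux of length `m`. -/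
def symmetricAlternativeTableaux (m : ℕ) : Set AlternativeTableau :=
  {T | T.IsSymmetric ∧ T.diagram.length = m}

/-- A tree-like tableau: a filling of some cells of a diagram without empty rows or columns with
points, subject to the three rules below. -/
@[ext]
structure TreeLikeTableau where
  /-- the underlying diagram -/
  diagram : Diagram
  /-- the pointed cells -/
  points : Finset (ℕ × ℕ)
  points_subset : ∀ c ∈ points, c ∈ diagram.shape
  row_nonempty : ∀ i < diagram.rows, (i, 0) ∈ diagram.shape
  col_nonempty : ∀ j < diagram.cols, (0, j) ∈ diagram.shape
  /-- the top left cell contains a point, the root -/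
  root_mem : (0, 0) ∈ points
  /-- for every non-root point there is either a point above it in its column, or a point to its
  left in its row, but not both -/
  parent : ∀ i j, (i, j) ∈ points → (i, j) ≠ (0, 0) →
    Xor (∃ i' < i, (i', j) ∈ points) (∃ j' < j, (i, j') ∈ points)
  /-- every row contains a point -/
  row_point : ∀ i < diagram.rows, ∃ j, (i, j) ∈ points
  /-- every column contains a point -/
  col_point : ∀ j < diagram.cols, ∃ i, (i, j) ∈ points

/-- The size of a tree-like tableau is its number of points. -/
def TreeLikeTableau.size (T : TreeLikeTableau) : ℕ := T.points.card

/-- A tree-like tableau is symmetric if it is unchanged by the reflection in its main diagonal. -/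
def TreeLikeTableau.IsSymmetric (T : TreeLikeTableau) : Prop :=
  T.diagram.reflect = T.diagram ∧ ∀ i j, (j, i) ∈ T.points ↔ (i, j) ∈ T.points

/-- The symmetric tree-like tableaux of size `m`. -/
def symmetricTreeLikeTableaux (m : ℕ) : Set TreeLikeTableau :=
  {T | T.IsSymmetric ∧ T.size = m}

/-- The corners of the type `B` permutation tableaux in `X`; corners of different tableaux count as
different, so a corner is recorded together with its tableau. -/
def typeBCorners (X : Set TypeBPermutationTableau) : Set (TypeBPermutationTableau × (ℕ × ℕ)) :=
  {p | p.1 ∈ X ∧ p.1.diagram.IsShiftedCorner p.2}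

/-- The corners of the alternative tableaux in `X`. -/
def alternativeCorners (X : Set AlternativeTableau) : Set (AlternativeTableau × (ℕ × ℕ)) :=
  {p | p.1 ∈ X ∧ p.1.diagram.IsCorner p.2}

/-- The corners of the tree-like tableaux in `X`. -/
def treeLikeCorners (X : Set TreeLikeTableau) : Set (TreeLikeTableau × (ℕ × ℕ)) :=
  {p | p.1 ∈ X ∧ p.1.diagram.IsCorner p.2}

end CornerCount

open CornerCount

open CornerCount

namespace CornerCount

/-! ### Diagrams, their corners, and adding or removing a line -/

namespace Diagram

/-! Everything is reduced to symmetric alternative tableaux of length `2 n`, and these are generated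
by adding one line at a time. Call a row free if it contains no left arrow, and let `F` be the set
of free rows of `T`. The extensions of `T` from `n` to `n + 1` are indexed by a Boolean `s` and a
subset `L` of `F` (`exists_extend`, `extend_injective`). A full left column is added with arrows
exactly in the rows of `L`, the topmost one pointing up if `s` is true and all others pointing left,
together with the mirrored top row. The index `(true, ∅)`, which would repeat the column of `(false,
∅)`, stands instead for adding an empty bottom row and an empty right column. In all cases the
extension has `|F| - |L| + 1` free rows (`card_freeRows_extend`).

Weight each tableau by `x` to the number of free rows. The binomial theorem turns the construction
into the recurrence `weightedSum_succ`, with `2 x (x + 1) ^ |F|` for all extensions together. For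
the count itself this gives `A_n(x) = 2 ^ n x (x + 1) ⋯ (x + n - 1)`, hence `A_n(1) = 2 ^ n n!`.

A new full line shifts the old corners and, when `n ≥ 1`, creates one corner below the diagonal (and
its mirror image) exactly if the old last row was empty; an empty line changes no corner. So the
weighted number `C_n` of corners below the diagonal satisfies a recurrence solved in closed form by
`weightedSum_lowerCorners`. A corner on the diagonal arises only from a full first line, hence
occurs in half of the tableaux of each positive length.

Finally, `toPermutation` and `toTreeLike` are bijections. The first cuts the diagram along its
diagonal, so shifted corners are corners below the diagonal. The second adds a full line to the
diagram, so its corners exceed the old ones by twice the number of tableaux with empty last row (for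
`n ≥ 1`). -/

theorem lt_of_mem (D : Diagram) {a b : ℕ} (h : (a, b) ∈ D.shape) : a < D.rows ∧ b < D.cols := by
  have h1 : (a, 0) ∈ D.shape := D.shape.up_left_mem le_rfl (Nat.zero_le b) h
  have h2 : (0, b) ∈ D.shape := D.shape.up_left_mem (Nat.zero_le a) le_rfl h
  rw [YoungDiagram.mem_iff_lt_colLen] at h1
  rw [YoungDiagram.mem_iff_lt_rowLen] at h2
  exact ⟨h1.trans_le D.colLen_le, h2.trans_le D.rowLen_le⟩

theorem eq_of_mem_iff {D E : Diagram} (hr : D.rows = E.rows) (hc : D.cols = E.cols)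
    (h : ∀ a b, (a, b) ∈ D.shape ↔ (a, b) ∈ E.shape) : D = E := by
  refine Diagram.ext (YoungDiagram.ext ?_) hr hc
  ext ⟨a, b⟩
  exact h a b

/-- The diagram whose cells are given by a relation that is closed to the left and upwards. -/
noncomputable def ofRel (m k : ℕ) (P : ℕ → ℕ → Prop)
    (hP : ∀ a b a' b', a' ≤ a → b' ≤ b → P a b → P a' b')
    (hb : ∀ a b, P a b → a < m ∧ b < k) : Diagram :=
  have hfin : {c : ℕ × ℕ | P c.1 c.2}.Finite :=
    ((Set.finite_Iio m).prod (Set.finite_Iio k)).subset fun c hc => hb c.1 c.2 hc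
  let Y : YoungDiagram :=
    ⟨hfin.toFinset, by
      rintro ⟨a, b⟩ ⟨a', b'⟩ hle h
      simp only [Set.Finite.coe_toFinset, Set.mem_ofPred_eq] at h ⊢
      exact hP a b a' b' hle.1 hle.2 h⟩
  have hY : ∀ a b, (a, b) ∈ Y ↔ P a b := fun a b => by
    change (a, b) ∈ hfin.toFinset ↔ _
    simp
  { shape := Y
    rows := m
    cols := k
    colLen_le := by
      by_contra! h
      rw [← YoungDiagram.mem_iff_lt_colLen, hY] at h
      exact lt_irrefl _ (hb _ _ h).1
    rowLen_le := by
      by_contra! h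
      rw [← YoungDiagram.mem_iff_lt_rowLen, hY] at h
      exact lt_irrefl _ (hb _ _ h).2 }

section ofRel
variable {m k : ℕ} {P : ℕ → ℕ → Prop} {hP : ∀ a b a' b', a' ≤ a → b' ≤ b → P a b → P a' b'}
  {hb : ∀ a b, P a b → a < m ∧ b < k}

@[simp] theorem mem_ofRel {a b : ℕ} : (a, b) ∈ (ofRel m k P hP hb).shape ↔ P a b := by
  change (a, b) ∈ Set.Finite.toFinset _ ↔ _
  simp

@[simp] theorem ofRel_rows : (ofRel m k P hP hb).rows = m := rfl

@[simp] theorem ofRel_cols : (ofRel m k P hP hb).cols = k := rfl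

end ofRel

/-- An edge of a cell is a border edge exactly when the neighbouring cell across it is missing, so
corners do not depend on the empty rows and columns of the rectangle. -/
theorem isCorner_iff (D : Diagram) (a b : ℕ) :
    D.IsCorner (a, b) ↔
      (a, b) ∈ D.shape ∧ (a, b + 1) ∉ D.shape ∧ (a + 1, b) ∉ D.shape := by
  unfold IsCorner IsVerticalBorderEdge IsHorizontalBorderEdge
  constructor
  · rintro ⟨h, ⟨-, h1⟩, -, h2⟩
    refine ⟨h, ?_, ?_⟩
    · rw [YoungDiagram.mem_iff_lt_rowLen]
      exact h1.symm.le.not_gt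
    · rw [YoungDiagram.mem_iff_lt_colLen]
      exact h2.symm.le.not_gt
  · rintro ⟨h, h1, h2⟩
    refine ⟨h, ⟨(D.lt_of_mem h).1, ?_⟩, (D.lt_of_mem h).2, ?_⟩
    · rw [YoungDiagram.mem_iff_lt_rowLen] at h h1
      simp only at h h1 ⊢
      omega
    · rw [YoungDiagram.mem_iff_lt_colLen] at h h2
      simp only at h h2 ⊢
      omega

/-- A staircase cell is never a corner, since the vertical border edges all lie in the rows of `D`.
-/
theorem isShiftedCorner_iff (D : Diagram) (a b : ℕ) :
    D.IsShiftedCorner (a, b) ↔ ∃ y, a = D.cols + y ∧ D.IsCorner (y, b) := by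
  unfold IsShiftedCorner shiftedCells IsCorner
  constructor
  · rintro ⟨h, ⟨y, rfl, h1⟩, z, hz, h2⟩
    obtain rfl : z = y + 1 := by simp only at hz; omega
    refine ⟨y, rfl, ?_, h1, h2⟩
    rcases h with h | ⟨i, hi, h⟩
    · simp only at h; omega
    · obtain rfl : y = i := by simp only at hi; omega
      exact h
  · rintro ⟨y, rfl, h, h1, h2⟩
    exact ⟨Or.inr ⟨y, rfl, h⟩, ⟨y, rfl, h1⟩, y + 1, by simp only; omega, h2⟩

theorem reflect_eq_iff (D : Diagram) :
    D.reflect = D ↔ D.cols = D.rows ∧ ∀ a b, (b, a) ∈ D.shape ↔ (a, b) ∈ D.shape := by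
  constructor
  · intro h
    refine ⟨congrArg Diagram.rows h, fun a b => ?_⟩
    conv_rhs => rw [← h]
    simp [reflect, YoungDiagram.mem_transpose]
  · rintro ⟨h, h'⟩
    refine eq_of_mem_iff h h.symm fun a b => ?_
    simpa [reflect, YoungDiagram.mem_transpose] using h' a b

/-- The diagram with a new full row on top and a new full column on the left. -/
noncomputable def addLine (D : Diagram) : Diagram :=
  ofRel (D.rows + 1) (D.cols + 1)
    (fun a b => a < D.rows + 1 ∧ b < D.cols + 1 ∧
      (a = 0 ∨ b = 0 ∨ (a - 1, b - 1) ∈ D.shape))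
    (by
      rintro a b a' b' ha hb ⟨h1, h2, h⟩
      refine ⟨by omega, by omega, ?_⟩
      rcases h with h | h | h
      · left; omega
      · right; left; omega
      · right; right
        exact D.shape.up_left_mem (by omega) (by omega) h)
    (fun a b h => ⟨h.1, h.2.1⟩)

@[simp] theorem addLine_rows (D : Diagram) : D.addLine.rows = D.rows + 1 := rfl

@[simp] theorem addLine_cols (D : Diagram) : D.addLine.cols = D.cols + 1 := rfl

@[simp] theorem mem_addLine_zero_left (D : Diagram) (b : ℕ) :
    (0, b) ∈ D.addLine.shape ↔ b < D.cols + 1 := by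
  simp [addLine]

@[simp] theorem mem_addLine_zero_right (D : Diagram) (a : ℕ) :
    (a, 0) ∈ D.addLine.shape ↔ a < D.rows + 1 := by
  simp [addLine]

@[simp] theorem mem_addLine_succ (D : Diagram) (a b : ℕ) :
    (a + 1, b + 1) ∈ D.addLine.shape ↔ (a, b) ∈ D.shape := by
  simp only [addLine, mem_ofRel, add_tsub_cancel_right, Nat.add_eq_zero_iff, one_ne_zero,
    and_false, false_or, add_lt_add_iff_right]
  exact ⟨fun h => h.2.2, fun h => ⟨(D.lt_of_mem h).1, (D.lt_of_mem h).2, h⟩⟩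

/-- The diagram without its top row and its leftmost column. -/
noncomputable def removeLine (D : Diagram) : Diagram :=
  ofRel (D.rows - 1) (D.cols - 1) (fun a b => (a + 1, b + 1) ∈ D.shape)
    (fun a b a' b' ha hb h => D.shape.up_left_mem (by omega) (by omega) h)
    (fun a b h => by have := D.lt_of_mem h; omega)

@[simp] theorem removeLine_rows (D : Diagram) : D.removeLine.rows = D.rows - 1 := rfl

@[simp] theorem removeLine_cols (D : Diagram) : D.removeLine.cols = D.cols - 1 := rfl

@[simp] theorem mem_removeLine (D : Diagram) (a b : ℕ) :
    (a, b) ∈ D.removeLine.shape ↔ (a + 1, b + 1) ∈ D.shape := by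
  simp [removeLine]

theorem addLine_removeLine (D : Diagram) (hr : 0 < D.rows) (hc : 0 < D.cols)
    (h1 : ∀ a < D.rows, (a, 0) ∈ D.shape) (h2 : ∀ b < D.cols, (0, b) ∈ D.shape) :
    D.removeLine.addLine = D := by
  refine eq_of_mem_iff (by simp; omega) (by simp; omega) fun a b => ?_
  rcases a with - | a
  · rw [mem_addLine_zero_left, removeLine_cols, Nat.sub_add_cancel hc]
    exact ⟨h2 b, fun h => (D.lt_of_mem h).2⟩
  · rcases b with - | b
    · rw [mem_addLine_zero_right, removeLine_rows, Nat.sub_add_cancel hr]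
      exact ⟨h1 _, fun h => (D.lt_of_mem h).1⟩
    · simp

theorem addLine_injective : Function.Injective addLine := by
  intro D E h
  refine eq_of_mem_iff ?_ ?_ fun a b => ?_
  · simpa using congrArg rows h
  · simpa using congrArg cols h
  · rw [← mem_addLine_succ, h, mem_addLine_succ]

/-- The diagram with a new empty row at the bottom and a new empty column on the right. -/
def addEmptyLine (D : Diagram) : Diagram where
  shape := D.shape
  rows := D.rows + 1
  cols := D.cols + 1
  colLen_le := D.colLen_le.trans (Nat.le_succ _)
  rowLen_le := D.rowLen_le.trans (Nat.le_succ _)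

/-- The bottom row of the rectangle exists and has no box. -/
def HasEmptyLastRow (D : Diagram) : Prop :=
  0 < D.rows ∧ (D.rows - 1, 0) ∉ D.shape

theorem isCorner_addEmptyLine (D : Diagram) (c : ℕ × ℕ) :
    D.addEmptyLine.IsCorner c ↔ D.IsCorner c := by
  obtain ⟨a, b⟩ := c
  simp only [isCorner_iff]
  rfl

theorem finite_isCorner (D : Diagram) (p : ℕ × ℕ → Prop) : {c | D.IsCorner c ∧ p c}.Finite :=
  (D.shape.cells.finite_toSet).subset fun _ hc => hc.1.1

theorem isCorner_addLine_succ (D : Diagram) (a b : ℕ) :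
    D.addLine.IsCorner (a + 1, b + 1) ↔ D.IsCorner (a, b) := by
  simp [isCorner_iff]

/-- Only the bottom cell of the new column has nothing below it; its right neighbour comes from the
first cell of the old last row. -/
theorem isCorner_addLine_zero_right (D : Diagram) (a : ℕ) :
    D.addLine.IsCorner (a + 1, 0) ↔ a + 1 = D.rows ∧ D.HasEmptyLastRow := by
  rw [isCorner_iff, mem_addLine_zero_right, mem_addLine_succ, mem_addLine_zero_right]
  unfold HasEmptyLastRow
  constructor
  · rintro ⟨h1, h2, h3⟩
    obtain rfl : a = D.rows - 1 := by omega
    exact ⟨by omega, by omega, h2⟩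
  · rintro ⟨h1, h2, h3⟩
    obtain rfl : a = D.rows - 1 := by omega
    exact ⟨by omega, h3, by omega⟩

theorem isCorner_addLine_zero_zero (D : Diagram) :
    D.addLine.IsCorner (0, 0) ↔ D.rows = 0 ∧ D.cols = 0 := by
  rw [isCorner_iff, mem_addLine_zero_right, mem_addLine_zero_right, mem_addLine_zero_left]
  omega

theorem isCorner_comm {D : Diagram} (h : D.reflect = D) (a b : ℕ) :
    D.IsCorner (b, a) ↔ D.IsCorner (a, b) := by
  rw [reflect_eq_iff] at h
  rw [isCorner_iff, isCorner_iff, h.2, h.2 (a + 1) b, h.2 a (b + 1), and_comm (a := (a + 1, b) ∉ _)]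

end Diagram

/-! ### Generating symmetric alternative tableaux line by line -/

@[simp] theorem Arrow.reflect_reflect (s : Arrow) : s.reflect.reflect = s := by
  cases s <;> rfl

theorem Arrow.map_reflect_eq_left {o : Option Arrow} :
    o.map Arrow.reflect = some Arrow.left ↔ o = some Arrow.up := by
  rcases o with - | (- | -) <;> simp [Arrow.reflect]

theorem Arrow.map_reflect_eq_up {o : Option Arrow} :
    o.map Arrow.reflect = some Arrow.up ↔ o = some Arrow.left := by
  rcases o with - | (- | -) <;> simp [Arrow.reflect]

theorem mem_symmetricAlternativeTableaux {n : ℕ} {T : AlternativeTableau} :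
    T ∈ symmetricAlternativeTableaux (2 * n) ↔
      T.diagram.rows = n ∧ T.diagram.cols = n ∧
      (∀ a b, (b, a) ∈ T.diagram.shape ↔ (a, b) ∈ T.diagram.shape) ∧
      ∀ a b, T.entry (b, a) = (T.entry (a, b)).map Arrow.reflect := by
  change (T.diagram.reflect = T.diagram ∧ _) ∧ T.diagram.rows + T.diagram.cols = _ ↔ _
  rw [Diagram.reflect_eq_iff]
  constructor
  · rintro ⟨⟨⟨h1, h2⟩, h3⟩, h4⟩
    exact ⟨by omega, by omega, h2, h3⟩
  · rintro ⟨h1, h2, h3, h4⟩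
    exact ⟨⟨⟨by omega, h3⟩, h4⟩, by omega⟩

namespace AlternativeTableau

theorem ext_entry {T U : AlternativeTableau} (h : T.diagram = U.diagram)
    (h' : ∀ a b, T.entry (a, b) = U.entry (a, b)) : T = U :=
  AlternativeTableau.ext h (funext fun c => h' c.1 c.2)

theorem mem_shape_of_entry {T : AlternativeTableau} {c : ℕ × ℕ} (h : T.entry c ≠ none) :
    c ∈ T.diagram.shape := by
  by_contra hc
  exact h (T.entry_eq_none c hc)

theorem IsSymmetric.entry_diag {T : AlternativeTableau} (hT : T.IsSymmetric) (a : ℕ) :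
    T.entry (a, a) = none := by
  have h := hT.2 a a
  rcases h' : T.entry (a, a) with - | (- | -) <;> simp [h', Arrow.reflect] at h ⊢

theorem IsSymmetric.entry_eq_up {T : AlternativeTableau} (hT : T.IsSymmetric) (a b : ℕ) :
    T.entry (a, b) = some Arrow.up ↔ T.entry (b, a) = some Arrow.left := by
  rw [hT.2 a b, Arrow.map_reflect_eq_left]

open scoped Classical in
/-- The rows without a left arrow. -/
noncomputable def freeRows (T : AlternativeTableau) : Finset ℕ :=
  {a ∈ Finset.range T.diagram.rows | ∀ b, T.entry (a, b) ≠ some Arrow.left}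

theorem mem_freeRows {T : AlternativeTableau} {a : ℕ} :
    a ∈ T.freeRows ↔ a < T.diagram.rows ∧ ∀ b, T.entry (a, b) ≠ some Arrow.left := by
  simp [freeRows]

/-- The tableau with a new empty row at the bottom and a new empty column on the right. -/
def addEmptyLine (T : AlternativeTableau) : AlternativeTableau where
  diagram := T.diagram.addEmptyLine
  entry := T.entry
  entry_eq_none := T.entry_eq_none
  left_condition := T.left_condition
  up_condition := T.up_condition

/-- The filling obtained from `e` by adding on the left the column with the entries of `c` below
its topmost cell, and by adding on top its reflection. -/
def lineEntry (e : ℕ × ℕ → Option Arrow) (c : ℕ → Option Arrow) : ℕ × ℕ → Option Arrow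
  | (0, 0) => none
  | (0, b + 1) => (c b).map Arrow.reflect
  | (a + 1, 0) => c a
  | (a + 1, b + 1) => e (a, b)

/-- The conditions under which `c` can be added to a symmetric tableau as a column. -/
structure IsColumn (T : AlternativeTableau) (c : ℕ → Option Arrow) : Prop where
  mem_freeRows : ∀ a, c a ≠ none → a ∈ T.freeRows
  up_condition : ∀ a, c a = some Arrow.up → ∀ a' < a, c a' = none

/-- The symmetric tableau obtained by adding a full column on the left and a full row on top. -/
noncomputable def addLine (T : AlternativeTableau) (hT : T.IsSymmetric) (c : ℕ → Option Arrow)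
    (hc : T.IsColumn c) : AlternativeTableau where
  diagram := T.diagram.addLine
  entry := lineEntry T.entry c
  entry_eq_none := by
    have hsq := (T.diagram.reflect_eq_iff.1 hT.1).1
    have key : ∀ a, ¬ a < T.diagram.rows → c a = none := fun a ha => by
      by_contra h
      exact ha (AlternativeTableau.mem_freeRows.1 (hc.mem_freeRows a h)).1
    rintro ⟨- | a, - | b⟩ h
    · rfl
    · rw [Diagram.mem_addLine_zero_left, hsq] at h
      simp [lineEntry, key b (by omega)]
    · rw [Diagram.mem_addLine_zero_right] at h
      exact key a (by omega)
    · rw [Diagram.mem_addLine_succ] at h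
      exact T.entry_eq_none _ h
  left_condition := by
    rintro (- | a) (- | b) h b' hb'
    · omega
    · rcases b' with - | b'
      · rfl
      -- A left arrow in the new top row mirrors an up arrow in the new column.
      · have := hc.up_condition b (Arrow.map_reflect_eq_left.1 h) b' (by omega)
        simp [lineEntry, this]
    · omega
    · rcases b' with - | b'
      · by_contra h'
        exact (AlternativeTableau.mem_freeRows.1 (hc.mem_freeRows a h')).2 b h
      · exact T.left_condition a b h b' (by omega)
  up_condition := by
    rintro (- | a) (- | b) h a' ha'
    · omega
    · omega
    · rcases a' with - | a'
      · rfl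
      · exact hc.up_condition a h a' (by omega)
    · rcases a' with - | a'
      -- An up arrow below a nonempty cell of the new top row mirrors a left arrow in a row that was
      -- required to be free.
      · by_contra h'
        have h'' : c b ≠ none := by simpa [lineEntry] using h'
        exact (AlternativeTableau.mem_freeRows.1 (hc.mem_freeRows b h'')).2 a
          ((hT.entry_eq_up a b).1 h)
      · exact T.up_condition a b h a' (by omega)

/-- The column with support `L`, whose topmost arrow is an up arrow if `s` is true, and whose
other arrows are left arrows. -/
def columnOf (s : Bool) (L : Finset ℕ) (a : ℕ) : Option Arrow :=
  if a ∈ L then (if s = true ∧ ∀ a' ∈ L, a ≤ a' then some Arrow.up else some Arrow.left) else none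

theorem columnOf_ne_none {s : Bool} {L : Finset ℕ} {a : ℕ} : columnOf s L a ≠ none ↔ a ∈ L := by
  unfold columnOf
  split_ifs <;> simp_all

theorem columnOf_eq_up {s : Bool} {L : Finset ℕ} {a : ℕ} :
    columnOf s L a = some Arrow.up ↔ a ∈ L ∧ s = true ∧ ∀ a' ∈ L, a ≤ a' := by
  unfold columnOf
  split_ifs <;> simp_all

theorem exists_columnOf_eq_up {s : Bool} {L : Finset ℕ} :
    (∃ a, columnOf s L a = some Arrow.up) ↔ s = true ∧ L.Nonempty := by
  simp only [columnOf_eq_up]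
  constructor
  · rintro ⟨a, h, hs, -⟩
    exact ⟨hs, a, h⟩
  · rintro ⟨hs, h⟩
    exact ⟨L.min' h, L.min'_mem h, hs, fun a' ha' => L.min'_le a' ha'⟩

theorem isColumn_columnOf {T : AlternativeTableau} {s : Bool} {L : Finset ℕ}
    (hL : L ⊆ T.freeRows) : T.IsColumn (columnOf s L) where
  mem_freeRows a h := hL (columnOf_ne_none.1 h)
  up_condition a h a' ha' := by
    by_contra h'
    exact ((columnOf_eq_up.1 h).2.2 a' (columnOf_ne_none.1 h')).not_gt ha'

/-- All cells above an up arrow are empty, so only the topmost arrow can point up, and the support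
together with the presence of an up arrow determines the column. Excluding `(true, ∅)` removes the
only ambiguity and reserves this index for the empty line. -/
theorem IsColumn.exists_eq_columnOf {T : AlternativeTableau} {c : ℕ → Option Arrow}
    (hc : T.IsColumn c) :
    ∃ s, ∃ L ⊆ T.freeRows, ¬ (s = true ∧ L = ∅) ∧ c = columnOf s L := by
  classical
  refine ⟨decide (∃ a, c a = some Arrow.up), {a ∈ T.freeRows | c a ≠ none},
    Finset.filter_subset _ _, ?_, ?_⟩
  · rintro ⟨h, h'⟩
    obtain ⟨a, ha⟩ := of_decide_eq_true h
    have hne : c a ≠ none := by simp [ha]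
    exact Finset.notMem_empty a (h' ▸ Finset.mem_filter.2 ⟨hc.mem_freeRows a hne, hne⟩)
  · have hmem : ∀ a, a ∈ ({a ∈ T.freeRows | c a ≠ none} : Finset ℕ) ↔ c a ≠ none := fun a => by
      rw [Finset.mem_filter]
      exact ⟨fun h => h.2, fun h => ⟨hc.mem_freeRows a h, h⟩⟩
    funext a
    unfold columnOf
    simp only [hmem, decide_eq_true_eq]
    rcases h : c a with - | (- | -)
    · simp
    · rw [if_pos (by simp), if_neg]
      rintro ⟨⟨a', ha'⟩, h'⟩
      have h1 := h' a' (by simp [ha'])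
      rcases h1.lt_or_eq with h2 | rfl
      · simp [hc.up_condition a' ha' a h2] at h
      · simp [h] at ha'
    · rw [if_pos (by simp), if_pos]
      refine ⟨⟨a, h⟩, fun a' ha' => ?_⟩
      by_contra h1
      exact ha' (hc.up_condition a h a' (by omega))

theorem addLine_injective {T U : AlternativeTableau} {hT : T.IsSymmetric} {hU : U.IsSymmetric}
    {c d : ℕ → Option Arrow} {hc : T.IsColumn c} {hd : U.IsColumn d}
    (h : T.addLine hT c hc = U.addLine hU d hd) : T = U ∧ c = d := by
  have h' : ∀ x, lineEntry T.entry c x = lineEntry U.entry d x :=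
    fun x => congrFun (congrArg entry h) x
  exact ⟨ext_entry (Diagram.addLine_injective (congrArg diagram h))
    fun a b => h' (a + 1, b + 1), funext fun a => h' (a + 1, 0)⟩

/-- The symmetric tableau obtained from `T` by adding a line at the outer end of its border: an
empty row and column if `s` is true and `L` is empty, a full row and column otherwise. -/
noncomputable def extend (T : AlternativeTableau) (hT : T.IsSymmetric) (s : Bool) (L : Finset ℕ)
    (hL : L ⊆ T.freeRows) : AlternativeTableau :=
  if s = true ∧ L = ∅ then T.addEmptyLine
  else T.addLine hT (columnOf s L) (isColumn_columnOf hL)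

theorem addEmptyLine_mem {n : ℕ} {T : AlternativeTableau}
    (h : T ∈ symmetricAlternativeTableaux (2 * n)) :
    T.addEmptyLine ∈ symmetricAlternativeTableaux (2 * (n + 1)) := by
  rw [mem_symmetricAlternativeTableaux] at h ⊢
  exact ⟨congrArg (· + 1) h.1, congrArg (· + 1) h.2.1, h.2.2⟩

theorem addLine_mem {n : ℕ} {T : AlternativeTableau}
    (h : T ∈ symmetricAlternativeTableaux (2 * n)) {c : ℕ → Option Arrow} (hc : T.IsColumn c) :
    T.addLine h.1 c hc ∈ symmetricAlternativeTableaux (2 * (n + 1)) := by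
  have h' := mem_symmetricAlternativeTableaux.1 h
  obtain ⟨h1, h2, h3, h4⟩ := h'
  rw [mem_symmetricAlternativeTableaux]
  refine ⟨congrArg (· + 1) h1, congrArg (· + 1) h2, ?_, ?_⟩
  · rintro (- | a) (- | b)
    · rfl
    · simp [addLine, h1, h2]
    · simp [addLine, h1, h2]
    · simpa [addLine] using h3 a b
  · rintro (- | a) (- | b)
    · rfl
    · simp [addLine, lineEntry, Function.comp_def]
    · rfl
    · exact h4 a b

theorem exists_addEmptyLine {n : ℕ} {T : AlternativeTableau}
    (h : T ∈ symmetricAlternativeTableaux (2 * (n + 1))) (hn : (n, 0) ∉ T.diagram.shape) :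
    ∃ U ∈ symmetricAlternativeTableaux (2 * n), U.addEmptyLine = T := by
  obtain ⟨h1, h2, h3, h4⟩ := mem_symmetricAlternativeTableaux.1 h
  have key : ∀ a b, (a, b) ∈ T.diagram.shape → a < n := fun a b hab => by
    have := (T.diagram.lt_of_mem hab).1
    by_contra ha
    exact hn (T.diagram.shape.up_left_mem (by omega) (by omega) hab)
  have hb : ∀ a b, (a, b) ∈ T.diagram.shape → a < n ∧ b < n := fun a b hab =>
    ⟨key a b hab, key b a ((h3 a b).2 hab)⟩
  let D : Diagram := Diagram.ofRel n n (fun a b => (a, b) ∈ T.diagram.shape)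
    (fun a b a' b' ha hb h => T.diagram.shape.up_left_mem ha hb h) hb
  have hD : ∀ c, c ∈ D.shape ↔ c ∈ T.diagram.shape := fun c => Diagram.mem_ofRel
  let U : AlternativeTableau :=
    ⟨D, T.entry, fun c hc => T.entry_eq_none c (by rwa [← hD]), T.left_condition, T.up_condition⟩
  refine ⟨U, mem_symmetricAlternativeTableaux.2 ⟨rfl, rfl, fun a b => ?_, h4⟩,
    ext_entry (Diagram.eq_of_mem_iff h1.symm h2.symm fun a b => hD (a, b)) fun a b => rfl⟩
  exact (hD _).trans ((h3 a b).trans (hD _).symm)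

/-- A box in the last cell of the first column makes that column full, and by symmetry also the
first row. An arrow in the first column forces its row to be free after the column is removed. -/
theorem exists_addLine {n : ℕ} {T : AlternativeTableau}
    (h : T ∈ symmetricAlternativeTableaux (2 * (n + 1))) (hn : (n, 0) ∈ T.diagram.shape) :
    ∃ U, ∃ hU : U ∈ symmetricAlternativeTableaux (2 * n), ∃ c, ∃ hc : U.IsColumn c,
      U.addLine hU.1 c hc = T := by
  obtain ⟨h1, h2, h3, h4⟩ := mem_symmetricAlternativeTableaux.1 h
  let U : AlternativeTableau :=
    { diagram := T.diagram.removeLine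
      entry := fun c => T.entry (c.1 + 1, c.2 + 1)
      entry_eq_none := fun c hc => T.entry_eq_none _ (by rwa [← Diagram.mem_removeLine])
      left_condition := fun a b hab b' hb' => T.left_condition _ _ hab _ (by simpa using hb')
      up_condition := fun a b hab a' ha' => T.up_condition _ _ hab _ (by simpa using ha') }
  have hU : U ∈ symmetricAlternativeTableaux (2 * n) := by
    refine mem_symmetricAlternativeTableaux.2 ⟨by simp [U, h1], by simp [U, h2], fun a b => ?_,
      fun a b => h4 _ _⟩
    simpa [U] using h3 _ _
  have hc : U.IsColumn (fun a => T.entry (a + 1, 0)) := by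
    refine ⟨fun a ha => AlternativeTableau.mem_freeRows.2 ⟨?_, fun b hb => ?_⟩,
      fun a ha a' ha' => T.up_condition _ _ ha _ (by omega)⟩
    · have := (T.diagram.lt_of_mem (mem_shape_of_entry ha)).1
      simp only [U, Diagram.removeLine_rows]
      omega
    · exact ha (T.left_condition _ _ hb _ (Nat.succ_pos _))
  refine ⟨U, hU, _, hc, ext_entry ?_ ?_⟩
  · have hcol : ∀ a < n + 1, (a, 0) ∈ T.diagram.shape := fun a ha =>
      T.diagram.shape.up_left_mem (by omega) le_rfl hn
    exact T.diagram.addLine_removeLine (by omega) (by omega) (by rwa [h1])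
      (by rw [h2]; exact fun b hb => (h3 _ _).2 (hcol b hb))
  · rintro (- | a) (- | b)
    · exact (h.1.entry_diag 0).symm
    · exact (h4 _ _).symm
    · rfl
    · rfl

theorem extend_mem {n : ℕ} {T : AlternativeTableau}
    (h : T ∈ symmetricAlternativeTableaux (2 * n)) (s : Bool) (L : Finset ℕ)
    (hL : L ⊆ T.freeRows) :
    T.extend h.1 s L hL ∈ symmetricAlternativeTableaux (2 * (n + 1)) := by
  unfold extend
  split_ifs
  · exact addEmptyLine_mem h
  · exact addLine_mem h _

theorem hasEmptyLastRow_addEmptyLine (T : AlternativeTableau) :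
    T.addEmptyLine.diagram.HasEmptyLastRow := by
  refine ⟨Nat.succ_pos _, fun h => ?_⟩
  exact lt_irrefl _ (T.diagram.lt_of_mem h).1

theorem not_hasEmptyLastRow_addLine {T : AlternativeTableau} {hT : T.IsSymmetric}
    {c : ℕ → Option Arrow} {hc : T.IsColumn c} :
    ¬ (T.addLine hT c hc).diagram.HasEmptyLastRow := by
  rintro ⟨-, h⟩
  simp [addLine] at h

theorem hasEmptyLastRow_extend {T : AlternativeTableau} {hT : T.IsSymmetric} {s : Bool}
    {L : Finset ℕ} {hL : L ⊆ T.freeRows} :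
    (T.extend hT s L hL).diagram.HasEmptyLastRow ↔ s = true ∧ L = ∅ := by
  unfold extend
  split_ifs with h
  · exact iff_of_true T.hasEmptyLastRow_addEmptyLine h
  · exact iff_of_false not_hasEmptyLastRow_addLine h

/-- An empty last row reveals that the empty line was added. Otherwise `L` is the support of the new
column, and `s` tells whether it contains an up arrow. -/
theorem extend_injective {T U : AlternativeTableau} {hT : T.IsSymmetric} {hU : U.IsSymmetric}
    {s t : Bool} {L M : Finset ℕ} {hL : L ⊆ T.freeRows} {hM : M ⊆ U.freeRows}
    (h : T.extend hT s L hL = U.extend hU t M hM) : T = U ∧ s = t ∧ L = M := by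
  have h' : (s = true ∧ L = ∅) ↔ (t = true ∧ M = ∅) := by
    rw [← hasEmptyLastRow_extend (hT := hT) (hL := hL), h, hasEmptyLastRow_extend]
  unfold extend at h
  split_ifs at h with h1 h2 h2
  · refine ⟨ext_entry (Diagram.eq_of_mem_iff ?_ ?_ fun a b => ?_)
      fun a b => congrFun (congrArg entry h) (a, b), by rw [h1.1, h2.1], by rw [h1.2, h2.2]⟩
    · exact Nat.succ_injective (congrArg (fun V => V.diagram.rows) h)
    · exact Nat.succ_injective (congrArg (fun V => V.diagram.cols) h)
    · exact iff_of_eq (congrArg (fun V => (a, b) ∈ V.diagram.shape) h)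
  · exact absurd (h'.1 h1) h2
  · exact absurd (h'.2 h2) h1
  · obtain ⟨h3, h4⟩ := addLine_injective h
    have hLM : L = M := by
      ext a
      rw [← columnOf_ne_none (s := s), h4, columnOf_ne_none]
    refine ⟨h3, ?_, hLM⟩
    have h5 : (s = true ∧ L.Nonempty) ↔ (t = true ∧ M.Nonempty) := by
      rw [← exists_columnOf_eq_up, h4, exists_columnOf_eq_up]
    subst hLM
    -- For empty `L` the column says nothing about `s`, but then `s` and `t` are both false by `h1`
    -- and `h2`.
    rcases L.eq_empty_or_nonempty with rfl | hne
    · cases s <;> cases t <;> simp_all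
    · cases s <;> cases t <;> simp_all

theorem exists_extend {n : ℕ} {T : AlternativeTableau}
    (h : T ∈ symmetricAlternativeTableaux (2 * (n + 1))) :
    ∃ U, ∃ hU : U ∈ symmetricAlternativeTableaux (2 * n), ∃ s L, ∃ hL : L ⊆ U.freeRows,
      U.extend hU.1 s L hL = T := by
  by_cases hn : (n, 0) ∈ T.diagram.shape
  · obtain ⟨U, hU, c, hc, rfl⟩ := exists_addLine h hn
    obtain ⟨s, L, hL, hs, rfl⟩ := hc.exists_eq_columnOf
    exact ⟨U, hU, s, L, hL, if_neg hs⟩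
  · obtain ⟨U, hU, rfl⟩ := exists_addEmptyLine h hn
    exact ⟨U, hU, true, ∅, Finset.empty_subset _, if_pos ⟨rfl, rfl⟩⟩

/-- If `s` is false, all rows of `L` stop being free and the new top row is free. If `s` is true and
`L` is nonempty, the topmost row of `L` stays free, but its up arrow is mirrored to a left arrow in
the new top row, so the count is the same. An added empty row is free. -/
theorem card_freeRows_extend {T : AlternativeTableau} {hT : T.IsSymmetric} {s : Bool}
    {L : Finset ℕ} {hL : L ⊆ T.freeRows} :
    (T.extend hT s L hL).freeRows.card = T.freeRows.card - L.card + 1 := by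
  classical
  unfold extend
  split_ifs with h
  · have : T.addEmptyLine.freeRows = insert T.diagram.rows T.freeRows := by
      ext a
      rw [Finset.mem_insert, mem_freeRows, mem_freeRows]
      change a < T.diagram.rows + 1 ∧ (∀ b, T.entry (a, b) ≠ _) ↔ _
      constructor
      · rintro ⟨h1, h2⟩
        rcases Nat.lt_succ_iff_lt_or_eq.1 h1 with h3 | h3
        · exact Or.inr ⟨h3, h2⟩
        · exact Or.inl h3
      · rintro (rfl | ⟨h1, h2⟩)
        · refine ⟨by omega, fun b hb => ?_⟩
          exact lt_irrefl _ (T.diagram.lt_of_mem (mem_shape_of_entry (hb ▸ Option.some_ne_none _))).1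
        · exact ⟨by omega, h2⟩
    rw [this, Finset.card_insert_of_notMem, h.2, Finset.card_empty, Nat.sub_zero]
    exact fun h' => lt_irrefl _ (mem_freeRows.1 h').1
  · have h0 : 0 ∈ (T.addLine hT (columnOf s L) (isColumn_columnOf hL)).freeRows ↔
        ¬ (s = true ∧ L.Nonempty) := by
      rw [mem_freeRows, ← exists_columnOf_eq_up]
      simp only [addLine, Diagram.addLine_rows, Nat.succ_pos, true_and, not_exists]
      constructor
      · intro h' a ha
        exact h' (a + 1) (Arrow.map_reflect_eq_left.2 ha)
      · rintro h' (- | b) hb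
        · simp [lineEntry] at hb
        · exact h' b (Arrow.map_reflect_eq_left.1 hb)
    have h1 : ∀ a, a + 1 ∈ (T.addLine hT (columnOf s L) (isColumn_columnOf hL)).freeRows ↔
        a ∈ T.freeRows ∧ columnOf s L a ≠ some Arrow.left := fun a => by
      rw [mem_freeRows, mem_freeRows]
      simp only [addLine, Diagram.addLine_rows, Nat.add_lt_add_iff_right, and_assoc]
      refine and_congr_right fun _ => ⟨fun h' => ⟨fun b => h' (b + 1), h' 0⟩, ?_⟩
      rintro ⟨h2, h3⟩ (- | b)
      · exact h3
      · exact h2 b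
    have hleft : ∀ a, columnOf s L a ≠ some Arrow.left ↔
        (a ∈ L → s = true ∧ ∀ a' ∈ L, a ≤ a') := fun a => by
      unfold columnOf
      split_ifs <;> simp_all
    simp only [hleft] at h1
    have hle := Finset.card_le_card hL
    by_cases hs : s = true
    · have hne : L.Nonempty := Finset.nonempty_iff_ne_empty.2 fun h' => h ⟨hs, h'⟩
      have : (T.addLine hT (columnOf s L) (isColumn_columnOf hL)).freeRows =
          (insert (L.min' hne) (T.freeRows \ L)).map ⟨Nat.succ, Nat.succ_injective⟩ := by
        ext (- | a)
        · rw [h0]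
          simp [hs, hne]
        · rw [h1]
          simp only [Finset.mem_map, Function.Embedding.coeFn_mk, Nat.succ_eq_add_one,
            Nat.add_right_cancel_iff, exists_eq_right, Finset.mem_insert, Finset.mem_sdiff]
          constructor
          · rintro ⟨h2, h3⟩
            by_cases ha : a ∈ L
            · exact Or.inl (le_antisymm ((h3 ha).2 _ (L.min'_mem hne)) (L.min'_le a ha))
            · exact Or.inr ⟨h2, ha⟩
          · rintro (rfl | ⟨h2, h3⟩)
            · exact ⟨hL (L.min'_mem hne), fun _ => ⟨hs, fun a' ha' => L.min'_le a' ha'⟩⟩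
            · exact ⟨h2, fun h4 => absurd h4 h3⟩
      rw [this, Finset.card_map, Finset.card_insert_of_notMem, Finset.card_sdiff_of_subset hL]
      exact fun h' => (Finset.mem_sdiff.1 h').2 (L.min'_mem hne)
    · have : (T.addLine hT (columnOf s L) (isColumn_columnOf hL)).freeRows =
          insert 0 ((T.freeRows \ L).map ⟨Nat.succ, Nat.succ_injective⟩) := by
        ext (- | a)
        · rw [h0]
          simp [hs]
        · rw [h1]
          simp [hs]
      rw [this, Finset.card_insert_of_notMem, Finset.card_map, Finset.card_sdiff_of_subset hL]
      simp

end AlternativeTableau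

/-! ### Corners below and on the main diagonal -/

namespace Diagram

/-- The number of corners below the main diagonal. -/
noncomputable def lowerCorners (D : Diagram) : ℕ := {c | D.IsCorner c ∧ c.2 < c.1}.ncard

/-- The number of corners on the main diagonal. -/
noncomputable def diagonalCorners (D : Diagram) : ℕ := {c | D.IsCorner c ∧ c.1 = c.2}.ncard

theorem lowerCorners_addEmptyLine (D : Diagram) :
    D.addEmptyLine.lowerCorners = D.lowerCorners := by
  simp only [lowerCorners, isCorner_addEmptyLine]

theorem diagonalCorners_addEmptyLine (D : Diagram) :
    D.addEmptyLine.diagonalCorners = D.diagonalCorners := by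
  simp only [diagonalCorners, isCorner_addEmptyLine]

theorem succ_succ_injective : Function.Injective fun c : ℕ × ℕ => (c.1 + 1, c.2 + 1) := by
  rintro ⟨a, b⟩ ⟨a', b'⟩ h
  simpa using h

-- Old corners move one step along the diagonal; the only possible new corner below the diagonal is
-- at the bottom of the new column.
open scoped Classical in
theorem lowerCorners_addLine (D : Diagram) :
    D.addLine.lowerCorners = D.lowerCorners + if D.HasEmptyLastRow then 1 else 0 := by
  have h : {c | D.addLine.IsCorner c ∧ c.2 < c.1} =
      (fun c : ℕ × ℕ => (c.1 + 1, c.2 + 1)) '' {c | D.IsCorner c ∧ c.2 < c.1} ∪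
        if D.HasEmptyLastRow then {(D.rows, 0)} else ∅ := by
    ext ⟨- | a, - | b⟩
    · split_ifs with h
      · simp [h.1.ne]
      · simp
    · split_ifs <;> simp
    · change D.addLine.IsCorner (a + 1, 0) ∧ 0 < a + 1 ↔ _
      rw [isCorner_addLine_zero_right]
      split_ifs with h <;> simp [h]
    · change D.addLine.IsCorner (a + 1, b + 1) ∧ b + 1 < a + 1 ↔ _
      rw [isCorner_addLine_succ]
      split_ifs <;> simp
  rw [lowerCorners, h, Set.ncard_union_eq ?_ ?_ ?_, Set.ncard_image_of_injective _ succ_succ_injective]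
  · split_ifs <;> simp [lowerCorners]
  · rw [Set.disjoint_left]
    rintro _ ⟨c, -, rfl⟩
    split_ifs <;> simp
  · exact (D.finite_isCorner _).image _
  · split_ifs <;> simp

open scoped Classical in
theorem diagonalCorners_addLine (D : Diagram) :
    D.addLine.diagonalCorners = D.diagonalCorners + if D.rows = 0 ∧ D.cols = 0 then 1 else 0 := by
  have h : {c | D.addLine.IsCorner c ∧ c.1 = c.2} =
      (fun c : ℕ × ℕ => (c.1 + 1, c.2 + 1)) '' {c | D.IsCorner c ∧ c.1 = c.2} ∪
        if D.rows = 0 ∧ D.cols = 0 then {(0, 0)} else ∅ := by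
    ext ⟨- | a, - | b⟩
    · change D.addLine.IsCorner (0, 0) ∧ 0 = 0 ↔ _
      rw [isCorner_addLine_zero_zero]
      split_ifs with h <;> simp [h]
    · split_ifs <;> simp
    · split_ifs <;> simp
    · change D.addLine.IsCorner (a + 1, b + 1) ∧ a + 1 = b + 1 ↔ _
      rw [isCorner_addLine_succ]
      split_ifs <;> simp
  rw [diagonalCorners, h, Set.ncard_union_eq ?_ ?_ ?_, Set.ncard_image_of_injective _ succ_succ_injective]
  · split_ifs <;> simp [diagonalCorners]
  · rw [Set.disjoint_left]
    rintro _ ⟨c, -, rfl⟩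
    split_ifs <;> simp
  · exact (D.finite_isCorner _).image _
  · split_ifs <;> simp

theorem ncard_isCorner {D : Diagram} (h : D.reflect = D) :
    {c | D.IsCorner c}.ncard = 2 * D.lowerCorners + D.diagonalCorners := by
  have h1 : {c | D.IsCorner c} = {c | D.IsCorner c ∧ c.2 < c.1} ∪
      Prod.swap '' {c | D.IsCorner c ∧ c.2 < c.1} ∪ {c | D.IsCorner c ∧ c.1 = c.2} := by
    ext ⟨a, b⟩
    have := isCorner_comm h a b
    simp only [Set.mem_ofPred_eq, Set.mem_union, Set.mem_image, Prod.exists, Prod.swap_prod_mk,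
      Prod.mk.injEq]
    constructor
    · intro hc
      rcases lt_trichotomy a b with hab | hab | hab
      · exact Or.inl (Or.inr ⟨b, a, ⟨this.2 hc, hab⟩, rfl, rfl⟩)
      · exact Or.inr ⟨hc, hab⟩
      · exact Or.inl (Or.inl ⟨hc, hab⟩)
    · rintro ((hc | ⟨b, a, ⟨hc, -⟩, rfl, rfl⟩) | hc)
      · exact hc.1
      · exact this.1 hc
      · exact hc.1
  have hfin := D.finite_isCorner fun c => c.2 < c.1
  rw [h1, Set.ncard_union_eq _ (hfin.union (hfin.image _)) (D.finite_isCorner _),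
    Set.ncard_union_eq _ hfin (hfin.image _), Set.ncard_image_of_injective _ Prod.swap_injective,
    ← two_mul]
  · rfl
  · rw [Set.disjoint_left]
    rintro _ ⟨-, hc⟩ ⟨c, ⟨-, hc'⟩, rfl⟩
    simp only [Prod.fst_swap, Prod.snd_swap] at hc
    omega
  · rw [Set.disjoint_left]
    rintro _ (⟨-, hc⟩ | ⟨c, ⟨-, hc⟩, rfl⟩) ⟨-, hc'⟩
    · omega
    · simp only [Prod.fst_swap, Prod.snd_swap] at hc'
      omega

end Diagram

/-! ### Sums weighted by the number of free rows -/

open AlternativeTableau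

theorem symmetricAlternativeTableaux_finite (n : ℕ) :
    (symmetricAlternativeTableaux (2 * n)).Finite := by
  induction n with
  | zero =>
    refine Set.Subsingleton.finite fun T hT U hU => ?_
    obtain ⟨h1, h2, -, -⟩ := mem_symmetricAlternativeTableaux.1 hT
    obtain ⟨h3, h4, -, -⟩ := mem_symmetricAlternativeTableaux.1 hU
    have hT' : ∀ c, c ∉ T.diagram.shape := fun c h => by
      have := T.diagram.lt_of_mem h
      omega
    have hU' : ∀ c, c ∉ U.diagram.shape := fun c h => by
      have := U.diagram.lt_of_mem h
      omega
    refine ext_entry (Diagram.eq_of_mem_iff (by omega) (by omega)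
      fun a b => iff_of_false (hT' _) (hU' _)) fun a b => ?_
    rw [T.entry_eq_none _ (hT' _), U.entry_eq_none _ (hU' _)]
  | succ n ih =>
    have := ih.to_subtype
    refine (Set.finite_range fun x : Σ T : symmetricAlternativeTableaux (2 * n),
      Bool × {L // L ∈ T.1.freeRows.powerset} =>
        x.1.1.extend x.1.2.1 x.2.1 x.2.2.1 (Finset.mem_powerset.1 x.2.2.2)).subset ?_
    intro T hT
    obtain ⟨U, hU, s, L, hL, rfl⟩ := exists_extend hT
    exact ⟨⟨⟨U, hU⟩, s, L, Finset.mem_powerset.2 hL⟩, rfl⟩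

noncomputable instance (n : ℕ) : Fintype (symmetricAlternativeTableaux (2 * n)) :=
  (symmetricAlternativeTableaux_finite n).fintype

theorem sum_symmetricAlternativeTableaux_succ {n : ℕ} (f : AlternativeTableau → ℚ)
    (g : AlternativeTableau → Bool → Finset ℕ → ℚ)
    (h : ∀ T, ∀ hT : T ∈ symmetricAlternativeTableaux (2 * n), ∀ s L, ∀ hL : L ⊆ T.freeRows,
      f (T.extend hT.1 s L hL) = g T s L) :
    ∑ T : symmetricAlternativeTableaux (2 * (n + 1)), f T =
      ∑ T : symmetricAlternativeTableaux (2 * n), ∑ s, ∑ L ∈ T.1.freeRows.powerset, g T s L := by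
  let φ : (Σ T : symmetricAlternativeTableaux (2 * n),
      Bool × {L // L ∈ T.1.freeRows.powerset}) → symmetricAlternativeTableaux (2 * (n + 1)) :=
    fun x => ⟨x.1.1.extend x.1.2.1 x.2.1 x.2.2.1 (Finset.mem_powerset.1 x.2.2.2),
      extend_mem x.1.2 _ _ _⟩
  have hφ : Function.Bijective φ := by
    constructor
    · rintro ⟨⟨T, hT⟩, s, L, hL⟩ ⟨⟨U, hU⟩, t, M, hM⟩ hx
      obtain ⟨rfl, rfl, rfl⟩ := extend_injective
        (hL := Finset.mem_powerset.1 hL) (hM := Finset.mem_powerset.1 hM) (congrArg Subtype.val hx)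
      rfl
    · rintro ⟨T, hT⟩
      obtain ⟨U, hU, s, L, hL, rfl⟩ := exists_extend hT
      exact ⟨⟨⟨U, hU⟩, s, L, Finset.mem_powerset.2 hL⟩, rfl⟩
  rw [← hφ.sum_comp, Fintype.sum_sigma]
  refine Finset.sum_congr rfl fun T _ => ?_
  rw [Fintype.sum_prod_type]
  refine Finset.sum_congr rfl fun s _ => ?_
  exact (Finset.sum_congr rfl fun L _ => h T.1 T.2 s L.1 (Finset.mem_powerset.1 L.2)).trans
    (Finset.sum_coe_sort _ _)

theorem sum_powerset_pow (F : Finset ℕ) (x : ℚ) :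
    ∑ L ∈ F.powerset, x ^ (F.card - L.card + 1) = x * (x + 1) ^ F.card := by
  rw [add_comm x 1, ← Finset.sum_pow_mul_eq_add_pow, Finset.mul_sum]
  exact Finset.sum_congr rfl fun L _ => by rw [one_pow, pow_succ]; ring

theorem sum_powerset_ite_pow (F : Finset ℕ) (x : ℚ) :
    ∑ s : Bool, ∑ L ∈ F.powerset,
      (if s = true ∧ L = ∅ then x ^ (F.card - L.card + 1) else 0) = x ^ (F.card + 1) := by
  rw [Fintype.sum_bool]
  simp [Finset.sum_ite_eq']

/-- The sum of `f` over the symmetric alternative tableaux of length `2 n`, weighted by powers of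
`x` that count the rows without a left arrow. -/
noncomputable def weightedSum (f : Diagram → ℚ) (n : ℕ) (x : ℚ) : ℚ :=
  ∑ T : symmetricAlternativeTableaux (2 * n), f T.1.diagram * x ^ T.1.freeRows.card

theorem weightedSum_one (f : Diagram → ℚ) (n : ℕ) :
    weightedSum f n 1 = ∑ T : symmetricAlternativeTableaux (2 * n), f T.1.diagram := by
  simp [weightedSum]

theorem weightedSum_zero (f : Diagram → ℚ) (x : ℚ) (c : ℚ)
    (hf : ∀ D : Diagram, D.rows = 0 → D.cols = 0 → f D = c) : weightedSum f 0 x = c := by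
  let D : Diagram := Diagram.ofRel 0 0 (fun _ _ => False) (by simp) (by simp)
  let T : AlternativeTableau := ⟨D, fun _ => none, fun _ _ => rfl, by simp, by simp⟩
  have hT : T ∈ symmetricAlternativeTableaux (2 * 0) := by
    rw [mem_symmetricAlternativeTableaux]
    refine ⟨rfl, rfl, fun a b => ?_, fun a b => rfl⟩
    simp [T, D]
  have huniv : ∀ U : symmetricAlternativeTableaux (2 * 0), U = ⟨T, hT⟩ := fun U => by
    obtain ⟨h1, h2, -, -⟩ := mem_symmetricAlternativeTableaux.1 U.2
    have hU' : ∀ c, c ∉ U.1.diagram.shape := fun c h => by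
      have := U.1.diagram.lt_of_mem h
      omega
    refine Subtype.ext (ext_entry (Diagram.eq_of_mem_iff h1 h2 fun a b => ?_) fun a b => ?_)
    · exact iff_of_false (hU' _) (by simp [T, D])
    · exact U.1.entry_eq_none _ (hU' _)
  have : Unique (symmetricAlternativeTableaux (2 * 0)) := ⟨⟨⟨T, hT⟩⟩, huniv⟩
  have hfree : T.freeRows = ∅ := by
    ext a
    simp [mem_freeRows, T, D]
  rw [weightedSum, Fintype.sum_unique, huniv default]
  simp [hfree, hf D rfl rfl, T]

/-- The number of extensions by a line, by a full one, and by an empty one, with weights. -/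
theorem weightedSum_succ (f g₁ g₂ : Diagram → ℚ) (n : ℕ) (x : ℚ)
    (h₁ : ∀ D : Diagram, D.rows = n → D.cols = n → f D.addLine = g₁ D)
    (h₂ : ∀ D : Diagram, D.rows = n → D.cols = n → f D.addEmptyLine = g₁ D + g₂ D) :
    weightedSum f (n + 1) x = 2 * x * weightedSum g₁ n (x + 1) + x * weightedSum g₂ n x := by
  unfold weightedSum
  -- Every pair `(s, L)` is counted as if a full line were added, with value `g₁`; `g₂` corrects the
  -- single pair `(true, ∅)`.
  rw [sum_symmetricAlternativeTableaux_succ (fun T => f T.diagram * x ^ T.freeRows.card)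
    (fun T s L => g₁ T.diagram * x ^ (T.freeRows.card - L.card + 1) +
      g₂ T.diagram * if s = true ∧ L = ∅ then x ^ (T.freeRows.card - L.card + 1) else 0)]
  · rw [Finset.mul_sum, Finset.mul_sum, ← Finset.sum_add_distrib]
    refine Finset.sum_congr rfl fun T _ => ?_
    simp only [Finset.sum_add_distrib, ← Finset.mul_sum]
    rw [sum_powerset_ite_pow, sum_powerset_pow, Fintype.sum_bool]
    ring
  · intro T hT s L hL
    obtain ⟨hr, hc, -, -⟩ := mem_symmetricAlternativeTableaux.1 hT
    rw [card_freeRows_extend]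
    unfold AlternativeTableau.extend
    split_ifs with h
    · change f T.diagram.addEmptyLine * _ = _
      rw [h₂ _ hr hc]
      ring
    · change f T.diagram.addLine * _ = _
      rw [h₁ _ hr hc]
      ring

theorem weightedSum_add (f g : Diagram → ℚ) (n : ℕ) (x : ℚ) :
    weightedSum (fun D => f D + g D) n x = weightedSum f n x + weightedSum g n x := by
  simp [weightedSum, add_mul, Finset.sum_add_distrib]

theorem weightedSum_neg (f : Diagram → ℚ) (n : ℕ) (x : ℚ) :
    weightedSum (fun D => -f D) n x = -weightedSum f n x := by
  simp [weightedSum]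

theorem weightedSum_const_zero (n : ℕ) (x : ℚ) : weightedSum (fun _ => 0) n x = 0 := by
  simp [weightedSum]

theorem weightedSum_const_one_succ (n : ℕ) (x : ℚ) :
    weightedSum (fun _ => 1) (n + 1) x = 2 * x * weightedSum (fun _ => 1) n (x + 1) := by
  rw [weightedSum_succ _ (fun _ => 1) (fun _ => 0) n x (by simp) (by simp),
    weightedSum_const_zero]
  ring

/-- The sum is `2 ^ n` times the rising factorial `x (x + 1) ⋯ (x + n - 1)`; the previous recurrence
splits off its first factor, this one its last. -/
theorem weightedSum_const_one_succ' (n : ℕ) (x : ℚ) :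
    weightedSum (fun _ => 1) (n + 1) x = 2 * (x + n) * weightedSum (fun _ => 1) n x := by
  induction n generalizing x with
  | zero =>
    rw [weightedSum_const_one_succ, weightedSum_zero _ _ 1 (fun _ _ _ => rfl),
      weightedSum_zero _ _ 1 (fun _ _ _ => rfl)]
    simp
  | succ n ih =>
    rw [weightedSum_const_one_succ, ih, weightedSum_const_one_succ n x]
    push_cast
    ring

theorem weightedSum_const_one_one (n : ℕ) :
    weightedSum (fun _ => 1) n 1 = 2 ^ n * (n.factorial : ℚ) := by
  induction n with
  | zero => simp [weightedSum_zero _ _ 1 (fun _ _ _ => rfl)]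
  | succ n ih =>
    rw [weightedSum_const_one_succ', ih, Nat.factorial_succ]
    push_cast
    ring

-- A full line never leaves the last row empty, so exactly one extension of each tableau counts, and
-- it has one more free row.
open scoped Classical in
theorem weightedSum_hasEmptyLastRow_succ (n : ℕ) (x : ℚ) :
    weightedSum (fun D => if D.HasEmptyLastRow then 1 else 0) (n + 1) x =
      x * weightedSum (fun _ => 1) n x := by
  rw [weightedSum_succ _ (fun _ => 0) (fun _ => 1) n x, weightedSum_const_zero]
  · ring
  · intro D _ _
    rw [if_neg]
    rintro ⟨-, h⟩
    simp at h
  · intro D _ _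
    rw [if_pos, zero_add]
    exact ⟨Nat.succ_pos _, fun h => lt_irrefl _ (D.lt_of_mem h).1⟩

/-- Of the two tableaux of length 2, only the one with a box has a diagonal corner, and both have
one free row. Later lines neither create nor destroy diagonal corners. -/
theorem weightedSum_diagonalCorners_succ (n : ℕ) (x : ℚ) :
    2 * weightedSum (fun D => D.diagonalCorners) (n + 1) x =
      weightedSum (fun _ => 1) (n + 1) x := by
  induction n generalizing x with
  | zero =>
    have h0 : ∀ D : Diagram, D.rows = 0 → D.diagonalCorners = 0 := fun D hD => by
      rw [Diagram.diagonalCorners, Set.ncard_eq_zero (D.finite_isCorner _)]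
      ext c
      simp only [Set.mem_ofPred_eq, Set.mem_empty_iff_false, iff_false]
      rintro ⟨h, -⟩
      have := D.lt_of_mem h.1
      omega
    rw [weightedSum_succ _ (fun _ => 1) (fun _ => -1) 0 x, weightedSum_const_one_succ,
      weightedSum_zero _ _ 1 (fun _ _ _ => rfl), weightedSum_zero _ _ (-1) (fun _ _ _ => rfl)]
    · ring
    · intro D hr hc
      simp [Diagram.diagonalCorners_addLine, h0 D hr, hr, hc]
    · intro D hr _
      simp [Diagram.diagonalCorners_addEmptyLine, h0 D hr]
  | succ n ih =>
    rw [weightedSum_succ _ (fun D => D.diagonalCorners) (fun _ => 0) (n + 1) x,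
      weightedSum_const_zero, weightedSum_const_one_succ, ← ih]
    · ring
    · intro D hr _
      simp [Diagram.diagonalCorners_addLine, hr]
    · intro D _ _
      simp [Diagram.diagonalCorners_addEmptyLine]

-- The subtracted term is for the empty line, which creates no corner even if the old last row was
-- empty.
open scoped Classical in
theorem weightedSum_lowerCorners_succ (n : ℕ) (x : ℚ) :
    weightedSum (fun D => D.lowerCorners) (n + 1) x =
      2 * x * weightedSum (fun D => D.lowerCorners) n (x + 1) +
      2 * x * weightedSum (fun D => if D.HasEmptyLastRow then 1 else 0) n (x + 1) -
      x * weightedSum (fun D => if D.HasEmptyLastRow then 1 else 0) n x := by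
  rw [weightedSum_succ _ (fun D => D.lowerCorners + if D.HasEmptyLastRow then 1 else 0)
    (fun D => -if D.HasEmptyLastRow then 1 else 0) n x, weightedSum_add, weightedSum_neg]
  · ring
  · intro D _ _
    rw [Diagram.lowerCorners_addLine]
    push_cast
    rfl
  · intro D _ _
    rw [Diagram.lowerCorners_addEmptyLine]
    ring

theorem weightedSum_lowerCorners_one (x : ℚ) :
    weightedSum (fun D => D.lowerCorners) 1 x = 0 := by
  have h0 : ∀ D : Diagram, D.rows = 0 → D.cols = 0 → (D.lowerCorners : ℚ) = 0 := fun D hD _ => by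
    rw [Nat.cast_eq_zero, Diagram.lowerCorners, Set.ncard_eq_zero (D.finite_isCorner _)]
    ext c
    simp only [Set.mem_ofPred_eq, Set.mem_empty_iff_false, iff_false]
    rintro ⟨h, -⟩
    have := D.lt_of_mem h.1
    omega
  classical
  have h1 : ∀ D : Diagram, D.rows = 0 → D.cols = 0 →
      (if D.HasEmptyLastRow then 1 else 0 : ℚ) = 0 := fun D hD _ =>
    if_neg fun h => h.1.ne' hD
  rw [weightedSum_lowerCorners_succ, weightedSum_zero _ _ 0 h0, weightedSum_zero _ _ 0 h1,
    weightedSum_zero _ _ 0 h1]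
  ring

/-- Writing `C_{n+2}(x) = A_n(x) p_n(x)`, the recurrence becomes `p_{n+1}(x) = p_n(x + 1) + 2 (x +
1) (x + n + 1) - x ^ 2`. Hence `p_n(x)` is the sum of `2 (x + i + 1) (x + n) - (x + i) ^ 2` over `0
≤ i ≤ n`, which evaluates to the stated polynomial. -/
theorem weightedSum_lowerCorners (n : ℕ) (x : ℚ) :
    weightedSum (fun D => D.lowerCorners) (n + 2) x =
      weightedSum (fun _ => 1) n x *
        ((n + 1) * (2 * (x + n) * (x + 1) - x ^ 2 + n ^ 2 - n * (2 * n + 1) / 6)) := by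
  classical
  induction n generalizing x with
  | zero =>
    rw [weightedSum_lowerCorners_succ, weightedSum_hasEmptyLastRow_succ,
      weightedSum_hasEmptyLastRow_succ, weightedSum_lowerCorners_one,
      weightedSum_zero _ _ 1 (fun _ _ _ => rfl), weightedSum_zero _ _ 1 (fun _ _ _ => rfl)]
    push_cast
    ring
  | succ n ih =>
    rw [weightedSum_lowerCorners_succ, weightedSum_hasEmptyLastRow_succ,
      weightedSum_hasEmptyLastRow_succ, ih]
    have h1 := weightedSum_const_one_succ n x
    have h2 := weightedSum_const_one_succ' n (x + 1)
    have h3 := weightedSum_const_one_succ' n x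
    rw [h2, h1]
    push_cast
    ring

/-! ### Bijection with symmetric tree-like tableaux -/

namespace TreeLikeTableau

theorem ext_points {S T : TreeLikeTableau} (h : S.diagram = T.diagram)
    (h' : ∀ a b, (a, b) ∈ S.points ↔ (a, b) ∈ T.points) : S = T :=
  TreeLikeTableau.ext h (Finset.ext fun c => h' c.1 c.2)

theorem lt_of_mem_points (T : TreeLikeTableau) {a b : ℕ} (h : (a, b) ∈ T.points) :
    a < T.diagram.rows ∧ b < T.diagram.cols :=
  T.diagram.lt_of_mem (T.points_subset _ h)

/-- The leftmost points of the rows and the topmost points of the columns cover all points, since no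
point has both a point above it and one to its left. Only the root, having neither, is counted
twice. -/
theorem rows_add_cols (T : TreeLikeTableau) :
    T.diagram.rows + T.diagram.cols = T.size + 1 := by
  classical
  let A := {c ∈ T.points | ¬ ∃ j' < c.2, (c.1, j') ∈ T.points}
  let B := {c ∈ T.points | ¬ ∃ i' < c.1, (i', c.2) ∈ T.points}
  have hA : A.card = T.diagram.rows := by
    rw [← Finset.card_range T.diagram.rows]
    refine Finset.card_bij (fun c _ => c.1) ?_ ?_ ?_
    · rintro ⟨a, b⟩ h
      exact Finset.mem_range.2 (T.lt_of_mem_points (Finset.mem_filter.1 h).1).1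
    · rintro ⟨a, b⟩ h ⟨a', b'⟩ h' rfl
      obtain ⟨h1, h2⟩ := Finset.mem_filter.1 h
      obtain ⟨h3, h4⟩ := Finset.mem_filter.1 h'
      rcases lt_trichotomy b b' with hb | rfl | hb
      · exact absurd ⟨b, hb, h1⟩ h4
      · rfl
      · exact absurd ⟨b', hb, h3⟩ h2
    · intro a ha
      have hex := T.row_point a (Finset.mem_range.1 ha)
      exact ⟨(a, Nat.find hex), Finset.mem_filter.2 ⟨Nat.find_spec hex,
        fun ⟨j, hj, h⟩ => Nat.find_min hex hj h⟩, rfl⟩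
  have hB : B.card = T.diagram.cols := by
    rw [← Finset.card_range T.diagram.cols]
    refine Finset.card_bij (fun c _ => c.2) ?_ ?_ ?_
    · rintro ⟨a, b⟩ h
      exact Finset.mem_range.2 (T.lt_of_mem_points (Finset.mem_filter.1 h).1).2
    · rintro ⟨a, b⟩ h ⟨a', b'⟩ h' rfl
      obtain ⟨h1, h2⟩ := Finset.mem_filter.1 h
      obtain ⟨h3, h4⟩ := Finset.mem_filter.1 h'
      rcases lt_trichotomy a a' with ha | rfl | ha
      · exact absurd ⟨a, ha, h1⟩ h4
      · rfl
      · exact absurd ⟨a', ha, h3⟩ h2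
    · intro b hb
      have hex := T.col_point b (Finset.mem_range.1 hb)
      exact ⟨(Nat.find hex, b), Finset.mem_filter.2 ⟨Nat.find_spec hex,
        fun ⟨j, hj, h⟩ => Nat.find_min hex hj h⟩, rfl⟩
  have hunion : A ∪ B = T.points := by
    rw [← Finset.filter_or, Finset.filter_eq_self]
    rintro ⟨a, b⟩ h
    by_cases h0 : (a, b) = (0, 0)
    · left
      rintro ⟨j, hj, -⟩
      simp only [Prod.mk.injEq] at h0 hj
      omega
    · rcases T.parent a b h h0 with h1 | h1
      · exact Or.inl h1.2
      · exact Or.inr h1.2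
  have hinter : A ∩ B = {(0, 0)} := by
    rw [← Finset.filter_and]
    ext ⟨a, b⟩
    rw [Finset.mem_filter, Finset.mem_singleton]
    constructor
    · rintro ⟨h, h1, h2⟩
      by_contra h0
      rcases T.parent a b h h0 with h3 | h3
      · exact h2 h3.1
      · exact h1 h3.1
    · intro h
      rw [h]
      exact ⟨T.root_mem, fun ⟨j, hj, _⟩ => Nat.not_lt_zero j hj,
        fun ⟨j, hj, _⟩ => Nat.not_lt_zero j hj⟩
  have := Finset.card_union_add_card_inter A B
  rw [hunion, hinter, hA, hB, Finset.card_singleton] at this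
  exact this.symm

theorem mem_symmetricTreeLikeTableaux {n : ℕ} {T : TreeLikeTableau} :
    T ∈ symmetricTreeLikeTableaux (2 * n + 1) ↔
      T.diagram.rows = n + 1 ∧ T.diagram.cols = n + 1 ∧
      (∀ a b, (b, a) ∈ T.diagram.shape ↔ (a, b) ∈ T.diagram.shape) ∧
      ∀ a b, (b, a) ∈ T.points ↔ (a, b) ∈ T.points := by
  have := T.rows_add_cols
  change (T.diagram.reflect = T.diagram ∧ _) ∧ T.size = _ ↔ _
  rw [Diagram.reflect_eq_iff]
  constructor
  · rintro ⟨⟨⟨h1, h2⟩, h3⟩, h4⟩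
    exact ⟨by omega, by omega, h2, h3⟩
  · rintro ⟨h1, h2, h3, h4⟩
    exact ⟨⟨⟨by omega, h3⟩, h4⟩, by omega⟩

end TreeLikeTableau

namespace AlternativeTableau

/-- The points of the tree-like tableau that corresponds to a symmetric alternative tableau: the
arrows, and points in the new leftmost column and top row for the lines without an arrow that
points to them. -/
def TreePoint (T : AlternativeTableau) : ℕ × ℕ → Prop
  | (0, 0) => True
  | (0, b + 1) => b ∈ T.freeRows
  | (a + 1, 0) => a ∈ T.freeRows
  | (a + 1, b + 1) => T.entry (a, b) ≠ none

theorem IsSymmetric.treePoint_comm {T : AlternativeTableau} (hT : T.IsSymmetric) (a b : ℕ) :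
    T.TreePoint (b, a) ↔ T.TreePoint (a, b) := by
  rcases a with - | a <;> rcases b with - | b
  · rfl
  · rfl
  · rfl
  · simp [TreePoint, hT.2 a b]

theorem TreePoint.mem_addLine {T : AlternativeTableau} (hT : T.IsSymmetric) :
    ∀ c, T.TreePoint c → c ∈ T.diagram.addLine.shape := by
  have hsq := (T.diagram.reflect_eq_iff.1 hT.1).1
  rintro ⟨- | a, - | b⟩ h
  · simp
  · rw [Diagram.mem_addLine_zero_left, hsq]
    exact Nat.succ_lt_succ (mem_freeRows.1 h).1
  · rw [Diagram.mem_addLine_zero_right]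
    exact Nat.succ_lt_succ (mem_freeRows.1 h).1
  · rw [Diagram.mem_addLine_succ]
    exact mem_shape_of_entry h

/-- If column `b` has no up arrow, there is a point above in the new top row. Otherwise its up arrow
is itself such a point: it cannot lie below `(a, b)`, which is not empty. The cells to the left are
empty, and row `a`, not being free, gets no point in the new column. -/
theorem IsSymmetric.treePoint_of_left {T : AlternativeTableau} (hT : T.IsSymmetric) {a b : ℕ}
    (h : T.entry (a, b) = some Arrow.left) :
    (∃ i < a + 1, T.TreePoint (i, b + 1)) ∧ ¬ ∃ j < b + 1, T.TreePoint (a + 1, j) := by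
  constructor
  · by_cases hb : b ∈ T.freeRows
    · exact ⟨0, Nat.succ_pos _, hb⟩
    · have hsq := (T.diagram.reflect_eq_iff.1 hT.1).1
      have hlt := (T.diagram.lt_of_mem (mem_shape_of_entry (h ▸ Option.some_ne_none _))).2
      rw [mem_freeRows, ← hsq] at hb
      push Not at hb
      obtain ⟨a', ha'⟩ := hb hlt
      rw [← hT.entry_eq_up] at ha'
      refine ⟨a' + 1, ?_, by simp [TreePoint, ha']⟩
      by_contra hle
      rcases (show a ≤ a' by omega).lt_or_eq with h1 | rfl
      · simp [T.up_condition a' b ha' a h1] at h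
      · simp [h] at ha'
  · rintro ⟨- | j, hj, hp⟩
    · exact (mem_freeRows.1 hp).2 b h
    · exact hp (T.left_condition a b h j (by omega))

theorem IsSymmetric.treePoint_of_up {T : AlternativeTableau} (hT : T.IsSymmetric) {a b : ℕ}
    (h : T.entry (a, b) = some Arrow.up) :
    (∃ j < b + 1, T.TreePoint (a + 1, j)) ∧ ¬ ∃ i < a + 1, T.TreePoint (i, b + 1) := by
  have := hT.treePoint_of_left ((hT.entry_eq_up a b).1 h)
  simpa only [hT.treePoint_comm] using this

theorem exists_treePoint_row {T : AlternativeTableau} {a : ℕ}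
    (ha : a < T.diagram.rows + 1) : ∃ b, T.TreePoint (a, b) := by
  rcases a with - | a
  · exact ⟨0, trivial⟩
  · by_cases h : a ∈ T.freeRows
    · exact ⟨0, h⟩
    · rw [mem_freeRows] at h
      push Not at h
      obtain ⟨b, hb⟩ := h (by omega)
      exact ⟨b + 1, by simp [TreePoint, hb]⟩

/-- The tree-like tableau that corresponds to a symmetric alternative tableau. -/
noncomputable def toTreeLike (T : AlternativeTableau) (hT : T.IsSymmetric) :
    TreeLikeTableau :=
  have hfin : {c | T.TreePoint c}.Finite :=
    T.diagram.addLine.shape.cells.finite_toSet.subset (TreePoint.mem_addLine hT)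
  have hmem : ∀ a b, (a, b) ∈ hfin.toFinset ↔ T.TreePoint (a, b) := by simp
  { diagram := T.diagram.addLine
    points := hfin.toFinset
    points_subset := fun c hc => TreePoint.mem_addLine hT c ((hmem c.1 c.2).1 hc)
    row_nonempty := fun i hi => by simpa using hi
    col_nonempty := fun i hi => by simpa using hi
    root_mem := (hmem _ _).2 trivial
    parent := by
      simp only [hmem]
      rintro (- | a) (- | b) h h0
      · exact absurd rfl h0
      · exact Or.inr ⟨⟨0, Nat.succ_pos _, trivial⟩, fun ⟨i, hi, _⟩ => Nat.not_lt_zero i hi⟩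
      · exact Or.inl ⟨⟨0, Nat.succ_pos _, trivial⟩, fun ⟨i, hi, _⟩ => Nat.not_lt_zero i hi⟩
      · rcases hab : T.entry (a, b) with - | (- | -)
        · exact absurd hab h
        · exact Or.inl (hT.treePoint_of_left hab)
        · exact Or.inr (hT.treePoint_of_up hab)
    row_point := by
      simp only [hmem]
      exact fun a ha => exists_treePoint_row ha
    col_point := by
      have hsq := (T.diagram.reflect_eq_iff.1 hT.1).1
      simp only [hmem, Diagram.addLine_cols, hsq]
      intro b hb
      obtain ⟨a, ha⟩ := exists_treePoint_row hb
      exact ⟨a, (hT.treePoint_comm _ _).1 ha⟩ }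

theorem mem_points_toTreeLike {T : AlternativeTableau} {hT : T.IsSymmetric} {a b : ℕ} :
    (a, b) ∈ (T.toTreeLike hT).points ↔ T.TreePoint (a, b) := by
  change (a, b) ∈ Set.Finite.toFinset _ ↔ _
  simp

theorem toTreeLike_mem {n : ℕ} {T : AlternativeTableau}
    (h : T ∈ symmetricAlternativeTableaux (2 * n)) :
    T.toTreeLike h.1 ∈ symmetricTreeLikeTableaux (2 * n + 1) := by
  obtain ⟨h1, h2, h3, -⟩ := mem_symmetricAlternativeTableaux.1 h
  rw [TreeLikeTableau.mem_symmetricTreeLikeTableaux]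
  refine ⟨congrArg (· + 1) h1, congrArg (· + 1) h2, ?_, fun a b => ?_⟩
  · rintro (- | a) (- | b)
    · rfl
    · simp [toTreeLike, h1, h2]
    · simp [toTreeLike, h1, h2]
    · simpa [toTreeLike] using h3 a b
  · rw [mem_points_toTreeLike, mem_points_toTreeLike, h.1.treePoint_comm]

theorem IsSymmetric.entry_eq_left_iff {T : AlternativeTableau} (hT : T.IsSymmetric) (a b : ℕ) :
    T.entry (a, b) = some Arrow.left ↔
      T.TreePoint (a + 1, b + 1) ∧ ¬ ∃ j < b + 1, T.TreePoint (a + 1, j) := by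
  constructor
  · intro h
    exact ⟨by simp [TreePoint, h], (hT.treePoint_of_left h).2⟩
  · rintro ⟨h, h'⟩
    rcases hab : T.entry (a, b) with - | (- | -)
    · exact absurd hab h
    · rfl
    · exact absurd (hT.treePoint_of_up hab).1 h'

theorem toTreeLike_injective {T U : AlternativeTableau} {hT : T.IsSymmetric}
    {hU : U.IsSymmetric} (h : T.toTreeLike hT = U.toTreeLike hU) : T = U := by
  have hp : ∀ a b, T.TreePoint (a, b) ↔ U.TreePoint (a, b) := fun a b => by
    rw [← mem_points_toTreeLike (hT := hT), h, mem_points_toTreeLike]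
  have hl : ∀ a b, T.entry (a, b) = some Arrow.left ↔ U.entry (a, b) = some Arrow.left :=
    fun a b => by simp only [hT.entry_eq_left_iff, hU.entry_eq_left_iff, hp]
  refine ext_entry (Diagram.addLine_injective (congrArg TreeLikeTableau.diagram h)) fun a b => ?_
  rcases hab : U.entry (a, b) with - | (- | -)
  · by_contra h'
    exact (hp (a + 1) (b + 1)).1 h' hab
  · exact (hl a b).2 hab
  · rw [hT.entry_eq_up, hl, ← hU.entry_eq_up, hab]

-- A point outside the first row and column becomes an up arrow if it has a point to its left, and a
-- left arrow if it has one above it.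
open scoped Classical in
theorem exists_toTreeLike {n : ℕ} {S : TreeLikeTableau}
    (h : S ∈ symmetricTreeLikeTableaux (2 * n + 1)) :
    ∃ T, ∃ hT : T ∈ symmetricAlternativeTableaux (2 * n), T.toTreeLike hT.1 = S := by
  obtain ⟨h1, h2, h3, h4⟩ := TreeLikeTableau.mem_symmetricTreeLikeTableaux.1 h
  have hadd : S.diagram.removeLine.addLine = S.diagram :=
    S.diagram.addLine_removeLine (by omega) (by omega) S.row_nonempty S.col_nonempty
  let e : ℕ × ℕ → Option Arrow := fun c =>
    if (c.1 + 1, c.2 + 1) ∈ S.points then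
      if ∃ j < c.2 + 1, (c.1 + 1, j) ∈ S.points then some Arrow.up else some Arrow.left
    else none
  have he0 : ∀ a b, e (a, b) ≠ none ↔ (a + 1, b + 1) ∈ S.points := fun a b => by
    simp only [e]
    split_ifs <;> simp_all
  have hel : ∀ a b, e (a, b) = some Arrow.left ↔
      (a + 1, b + 1) ∈ S.points ∧ ¬ ∃ j < b + 1, (a + 1, j) ∈ S.points := fun a b => by
    simp only [e]
    split_ifs <;> simp_all
  have heu : ∀ a b, e (a, b) = some Arrow.up ↔
      (a + 1, b + 1) ∈ S.points ∧ ∃ j < b + 1, (a + 1, j) ∈ S.points := fun a b => by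
    simp only [e]
    split_ifs <;> simp_all
  have hxor : ∀ a b, (a + 1, b + 1) ∈ S.points →
      ((∃ i < a + 1, (i, b + 1) ∈ S.points) ↔ ¬ ∃ j < b + 1, (a + 1, j) ∈ S.points) :=
    fun a b hab => by
      rcases S.parent _ _ hab (by simp) with h' | h'
      · exact iff_of_true h'.1 h'.2
      · exact iff_of_false h'.2 (not_not.2 h'.1)
  let T : AlternativeTableau :=
    { diagram := S.diagram.removeLine
      entry := e
      entry_eq_none := by
        rintro ⟨a, b⟩ hc
        by_contra hne
        exact hc ((Diagram.mem_removeLine _ _ _).2 (S.points_subset _ ((he0 _ _).1 hne)))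
      left_condition := fun a b hab b' hb' => by
        by_contra hne
        exact ((hel _ _).1 hab).2 ⟨b' + 1, by omega, (he0 _ _).1 hne⟩
      up_condition := fun a b hab a' ha' => by
        by_contra hne
        obtain ⟨h5, h6⟩ := (heu _ _).1 hab
        exact ((hxor _ _ h5).1 ⟨a' + 1, by omega, (he0 _ _).1 hne⟩) h6 }
  have hsymm : ∀ a b, e (b, a) = (e (a, b)).map Arrow.reflect := fun a b => by
    have hm := h4 (a + 1) (b + 1)
    have hx := hxor a b
    have hl : (∃ j < a + 1, (b + 1, j) ∈ S.points) ↔ ∃ i < a + 1, (i, b + 1) ∈ S.points := by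
      simp only [h4 _ (b + 1)]
    simp only [e, hm, hl]
    by_cases hab : (a + 1, b + 1) ∈ S.points
    · simp only [hab, if_true, hx hab]
      split_ifs <;> rfl
    · simp [hab]
  have hT : T ∈ symmetricAlternativeTableaux (2 * n) := by
    refine mem_symmetricAlternativeTableaux.2 ⟨?_, ?_, fun a b => ?_, hsymm⟩
    · simp [T, h1]
    · simp [T, h2]
    · simpa [T] using h3 _ _
  -- The leftmost point of a row, unless it is in column `0`, becomes a left arrow.
  have hfree : ∀ a, a ∈ T.freeRows ↔ (a + 1, 0) ∈ S.points := fun a => by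
    rw [mem_freeRows]
    constructor
    · rintro ⟨ha, hl⟩
      have hr : a + 1 < S.diagram.rows := by
        simp only [T, Diagram.removeLine_rows] at ha
        omega
      have hex := S.row_point _ hr
      rcases hj : Nat.find hex with - | j
      · exact hj ▸ Nat.find_spec hex
      · refine absurd ((hel a j).2 ⟨hj ▸ Nat.find_spec hex, ?_⟩) (hl j)
        rintro ⟨j', hj', hp⟩
        exact Nat.find_min hex (hj ▸ hj') hp
    · intro ha
      have hr := (S.lt_of_mem_points ha).1
      refine ⟨by simp only [T, Diagram.removeLine_rows]; omega, fun b hb => ?_⟩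
      exact ((hel a b).1 hb).2 ⟨0, Nat.succ_pos _, ha⟩
  refine ⟨T, hT, TreeLikeTableau.ext_points hadd ?_⟩
  rintro (- | a) (- | b)
  · exact iff_of_true (mem_points_toTreeLike.2 trivial) S.root_mem
  · rw [mem_points_toTreeLike, h4]
    exact hfree b
  · rw [mem_points_toTreeLike]
    exact hfree a
  · rw [mem_points_toTreeLike]
    exact he0 a b

end AlternativeTableau

/-! ### Cutting a symmetric diagram along its diagonal -/

namespace Diagram

theorem exists_diag_notMem (D : Diagram) : ∃ d, (d, d) ∉ D.shape :=
  ⟨D.rows, fun h => lt_irrefl _ (D.lt_of_mem h).1⟩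

open scoped Classical in
/-- The side of the largest square in the upper left corner of the diagram. -/
noncomputable def durfee (D : Diagram) : ℕ := Nat.find D.exists_diag_notMem

theorem diag_mem_iff (D : Diagram) (a : ℕ) : (a, a) ∈ D.shape ↔ a < D.durfee := by
  classical
  constructor
  · intro h
    by_contra! hle
    exact Nat.find_spec D.exists_diag_notMem (D.shape.up_left_mem hle hle h)
  · intro h
    exact not_not.1 (Nat.find_min D.exists_diag_notMem h)

theorem durfee_le_rows (D : Diagram) : D.durfee ≤ D.rows := by
  by_contra! h
  exact lt_irrefl _ (D.lt_of_mem ((D.diag_mem_iff _).2 h)).1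

theorem lt_durfee_of_mem (D : Diagram) {a b : ℕ} (h : (a, b) ∈ D.shape) (ha : D.durfee ≤ a) :
    b < D.durfee := by
  by_contra! hb
  exact lt_irrefl _ ((D.diag_mem_iff _).1 (D.shape.up_left_mem ha hb h))

/-- The diagram whose shifted diagram is the part of `D` on and below the main diagonal. -/
noncomputable def fold (D : Diagram) : Diagram :=
  ofRel (D.rows - D.durfee) D.durfee (fun i b => (D.durfee + i, b) ∈ D.shape)
    (fun a b a' b' ha hb h => D.shape.up_left_mem (by omega) hb h)
    (fun a b h => ⟨by have := (D.lt_of_mem h).1; omega, D.lt_durfee_of_mem h (by omega)⟩)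

theorem fold_length (D : Diagram) : D.fold.length = D.rows :=
  Nat.sub_add_cancel D.durfee_le_rows

theorem mem_shiftedCells_fold (D : Diagram) {a b : ℕ} :
    (a, b) ∈ D.fold.shiftedCells ↔ b ≤ a ∧ (a, b) ∈ D.shape := by
  simp only [shiftedCells, fold, mem_ofRel, ofRel_cols, Set.mem_ofPred_eq]
  constructor
  · rintro (⟨h1, h2⟩ | ⟨i, rfl, h⟩)
    · exact ⟨h2, D.shape.up_left_mem le_rfl h2 ((D.diag_mem_iff a).2 h1)⟩
    · have := D.lt_durfee_of_mem h (by omega)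
      exact ⟨by omega, h⟩
  · rintro ⟨h1, h2⟩
    rcases lt_or_ge a D.durfee with h | h
    · exact Or.inl ⟨h, h1⟩
    · obtain ⟨i, rfl⟩ := Nat.exists_eq_add_of_le h
      exact Or.inr ⟨i, rfl, h2⟩

/-- In the rows of the Durfee square, a cell strictly below the diagonal has a right neighbour and
is no corner; below the square every cell is strictly below the diagonal. -/
theorem isShiftedCorner_fold (D : Diagram) (c : ℕ × ℕ) :
    D.fold.IsShiftedCorner c ↔ D.IsCorner c ∧ c.2 < c.1 := by
  obtain ⟨a, b⟩ := c
  simp only [isShiftedCorner_iff, isCorner_iff, fold, mem_ofRel, ofRel_cols, ← add_assoc]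
  constructor
  · rintro ⟨y, rfl, h⟩
    have := D.lt_durfee_of_mem h.1 (by omega)
    exact ⟨h, by omega⟩
  · rintro ⟨h, hab⟩
    have : D.durfee ≤ a := by
      by_contra! ha
      exact h.2.1 (D.shape.up_left_mem le_rfl hab ((D.diag_mem_iff a).2 ha))
    obtain ⟨y, rfl⟩ := Nat.exists_eq_add_of_le this
    exact ⟨y, rfl, h⟩

theorem snd_lt_cols_of_mem_shiftedCells {D : Diagram} {a b : ℕ} (h : (a, b) ∈ D.shiftedCells) :
    b < D.cols := by
  rcases h with ⟨h1, h2⟩ | ⟨i, -, h⟩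
  · exact lt_of_le_of_lt h2 h1
  · exact (D.lt_of_mem h).2

theorem le_of_mem_shiftedCells {D : Diagram} {a b : ℕ} (h : (a, b) ∈ D.shiftedCells) :
    b ≤ a := by
  rcases h with ⟨-, h⟩ | ⟨i, hi, h⟩
  · exact h
  · have := (D.lt_of_mem h).2
    simp only at hi
    omega

theorem diag_mem_shiftedCells {D : Diagram} {a : ℕ} :
    (a, a) ∈ D.shiftedCells ↔ a < D.cols :=
  ⟨snd_lt_cols_of_mem_shiftedCells, fun h => Or.inl ⟨h, le_rfl⟩⟩

/-- The symmetric diagram whose part on and below the main diagonal is the shifted diagram. -/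
noncomputable def unfold (D : Diagram) : Diagram :=
  ofRel D.length D.length (fun a b => (max a b, min a b) ∈ D.shiftedCells)
    (by
      rintro a b a' b' ha hb (⟨h1, h2⟩ | ⟨i, hi, h⟩)
      · left
        simp only at h1 ⊢
        omega
      · simp only at hi h
        rcases lt_or_ge (max a' b') D.cols with hlt | hge
        · left
          simp only
          omega
        · obtain ⟨i', hi'⟩ := Nat.exists_eq_add_of_le hge
          exact Or.inr ⟨i', hi', D.shape.up_left_mem (by omega) (by omega) h⟩)
    (by
      rintro a b (⟨h1, h2⟩ | ⟨i, hi, h⟩)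
      · simp only [length] at h1 ⊢
        omega
      · have := (D.lt_of_mem h).1
        simp only [length] at hi ⊢
        omega)

theorem mem_unfold {D : Diagram} {a b : ℕ} :
    (a, b) ∈ D.unfold.shape ↔ (max a b, min a b) ∈ D.shiftedCells := mem_ofRel

theorem mem_unfold_comm {D : Diagram} {a b : ℕ} :
    (b, a) ∈ D.unfold.shape ↔ (a, b) ∈ D.unfold.shape := by
  rw [mem_unfold, mem_unfold, max_comm, min_comm]

theorem mem_unfold_of_le {D : Diagram} {a b : ℕ} (h : b ≤ a) :
    (a, b) ∈ D.unfold.shape ↔ (a, b) ∈ D.shiftedCells := by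
  rw [mem_unfold, max_eq_left h, min_eq_right h]

theorem durfee_unfold (D : Diagram) : D.unfold.durfee = D.cols := by
  have h : ∀ a, a < D.unfold.durfee ↔ a < D.cols := fun a => by
    rw [← diag_mem_iff, mem_unfold_of_le le_rfl, diag_mem_shiftedCells]
  have h1 := h D.cols
  have h2 := h D.unfold.durfee
  omega

theorem fold_unfold (D : Diagram) : D.unfold.fold = D := by
  refine eq_of_mem_iff ?_ D.durfee_unfold fun i b => ?_
  · change D.length - D.unfold.durfee = D.rows
    rw [durfee_unfold, length, Nat.add_sub_cancel]
  · simp only [fold, mem_ofRel, durfee_unfold, mem_unfold]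
    constructor
    · intro h
      have hb := snd_lt_cols_of_mem_shiftedCells h
      rw [max_eq_left (by omega), min_eq_right (by omega)] at h
      rcases h with ⟨h, -⟩ | ⟨i', hi, h⟩
      · simp only at h
        omega
      · obtain rfl : i = i' := by simp only at hi; omega
        exact h
    · intro h
      have := (D.lt_of_mem h).2
      rw [max_eq_left (by omega), min_eq_right (by omega)]
      exact Or.inr ⟨i, rfl, h⟩

theorem eq_of_fold_eq {D E : Diagram} (hD : D.reflect = D) (hE : E.reflect = E)
    (h : D.fold = E.fold) : D = E := by
  rw [reflect_eq_iff] at hD hE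
  have hrows : D.rows = E.rows := by rw [← fold_length, h, fold_length]
  have key : ∀ a b, b ≤ a → ((a, b) ∈ D.shape ↔ (a, b) ∈ E.shape) := fun a b hab => by
    have h1 := D.mem_shiftedCells_fold (a := a) (b := b)
    rw [h, mem_shiftedCells_fold] at h1
    simpa [hab] using h1.symm
  refine eq_of_mem_iff hrows (by rw [hD.1, hE.1, hrows]) fun a b => ?_
  rcases le_total b a with hab | hab
  · exact key a b hab
  · rw [← hD.2, ← hE.2]
    exact key b a hab

end Diagram

/-! ### Bijection with type `B` permutation tableaux -/

namespace TypeBPermutationTableau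

theorem ext_ones {S T : TypeBPermutationTableau} (h : S.diagram = T.diagram)
    (h' : ∀ a b, (a, b) ∈ S.ones ↔ (a, b) ∈ T.ones) : S = T :=
  TypeBPermutationTableau.ext h (Finset.ext fun c => h' c.1 c.2)

end TypeBPermutationTableau

namespace AlternativeTableau

/-- The cells that contain a `1` in the type `B` permutation tableau that corresponds to a
symmetric alternative tableau: those on or below the main diagonal that neither lie to the left of
or on a left arrow nor above an up arrow. -/
def IsOne (T : AlternativeTableau) (a b : ℕ) : Prop :=
  b ≤ a ∧ (a, b) ∈ T.diagram.shape ∧ (∀ b', b ≤ b' → T.entry (a, b') ≠ some Arrow.left) ∧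
    ∀ a', a < a' → T.entry (a', b) ≠ some Arrow.up

theorem isOne_of_up {T : AlternativeTableau} {a b : ℕ} (hab : b ≤ a)
    (h : T.entry (a, b) = some Arrow.up) : T.IsOne a b := by
  refine ⟨hab, mem_shape_of_entry (h ▸ Option.some_ne_none _), fun b' hb' h' => ?_,
    fun a' ha' h' => ?_⟩
  · rcases hb'.lt_or_eq with hlt | rfl
    · simp [T.left_condition a b' h' b hlt] at h
    · simp [h] at h'
  · simp [T.up_condition a' b h' a ha'] at h

theorem not_isOne {T : AlternativeTableau} {a b : ℕ} (hab : b ≤ a)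
    (hmem : (a, b) ∈ T.diagram.shape) (h : ¬ T.IsOne a b) :
    (∃ b', b ≤ b' ∧ T.entry (a, b') = some Arrow.left) ∨
      ∃ a', a < a' ∧ T.entry (a', b) = some Arrow.up := by
  by_contra! h'
  exact h ⟨hab, hmem, h'.1, h'.2⟩

/-- A left arrow in row `j` to the right of the diagonal mirrors an up arrow in column `j` below it.
-/
theorem IsSymmetric.exists_up_of_diag {T : AlternativeTableau} (hT : T.IsSymmetric) {j : ℕ}
    (hmem : (j, j) ∈ T.diagram.shape) (h : ¬ T.IsOne j j) :
    ∃ a, j < a ∧ T.entry (a, j) = some Arrow.up := by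
  rcases not_isOne le_rfl hmem h with ⟨b, hb, h'⟩ | h'
  · rcases hb.lt_or_eq with hlt | rfl
    · exact ⟨b, hlt, (hT.entry_eq_up b j).2 h'⟩
    · simp [hT.entry_diag] at h'
  · exact h'

/-- The type `B` permutation tableau that corresponds to a symmetric alternative tableau. -/
noncomputable def toPermutation (T : AlternativeTableau) (hT : T.IsSymmetric) :
    TypeBPermutationTableau :=
  have hfin : {c : ℕ × ℕ | T.IsOne c.1 c.2}.Finite :=
    T.diagram.shape.cells.finite_toSet.subset fun c hc => hc.2.1
  have hmem : ∀ a b, (a, b) ∈ hfin.toFinset ↔ T.IsOne a b := by simp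
  { diagram := T.diagram.fold
    ones := hfin.toFinset
    ones_subset := fun c hc => by
      have h := (hmem c.1 c.2).1 hc
      exact T.diagram.mem_shiftedCells_fold.2 ⟨h.1, h.2.1⟩
    exists_one := by
      simp only [hmem]
      intro j hj
      by_cases h : T.IsOne j j
      · exact ⟨j, h⟩
      · obtain ⟨a, ha, hup⟩ := hT.exists_up_of_diag ((T.diagram.diag_mem_iff j).2 hj) h
        exact ⟨a, isOne_of_up ha.le hup⟩
    zero_condition := by
      simp only [hmem, Diagram.mem_shiftedCells_fold]
      rintro a b ⟨hab, hsh⟩ h ⟨⟨a', ha', h1⟩, ⟨b', hb', h2⟩⟩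
      rcases not_isOne hab hsh h with ⟨b'', hb'', h3⟩ | ⟨a'', ha'', h3⟩
      · exact h2.2.2.1 b'' (by omega) h3
      · exact h1.2.2.2 a'' (by omega) h3
    diagonal_condition := by
      simp only [hmem]
      intro j hj h b hb h1
      obtain ⟨a, ha, hup⟩ := hT.exists_up_of_diag ((T.diagram.diag_mem_iff j).2 hj) h
      exact h1.2.2.1 a (by omega) ((hT.entry_eq_up a j).1 hup) }

theorem mem_ones_toPermutation {T : AlternativeTableau} {hT : T.IsSymmetric} {a b : ℕ} :
    (a, b) ∈ (T.toPermutation hT).ones ↔ T.IsOne a b := by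
  change (a, b) ∈ Set.Finite.toFinset _ ↔ _
  simp

theorem toPermutation_mem {n : ℕ} {T : AlternativeTableau}
    (h : T ∈ symmetricAlternativeTableaux (2 * n)) :
    T.toPermutation h.1 ∈ typeBPermutationTableaux n :=
  T.diagram.fold_length.trans (mem_symmetricAlternativeTableaux.1 h).1

/-- If the topmost `1` of a column is below the diagonal, the diagonal cell is `0`, so the column
has an up arrow. That arrow is on a `1`, with only `0`s above it, hence on the topmost one. -/
theorem IsSymmetric.entry_eq_up_iff {T : AlternativeTableau} (hT : T.IsSymmetric) {a b : ℕ}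
    (hab : b < a) :
    T.entry (a, b) = some Arrow.up ↔ T.IsOne a b ∧ ∀ a' < a, ¬ T.IsOne a' b := by
  constructor
  · intro h
    exact ⟨isOne_of_up hab.le h, fun a' ha' h' => h'.2.2.2 a ha' h⟩
  · rintro ⟨h, h'⟩
    have hdiag : (b, b) ∈ T.diagram.shape := T.diagram.shape.up_left_mem hab.le le_rfl h.2.1
    obtain ⟨a', ha', hup⟩ := hT.exists_up_of_diag hdiag (h' b hab)
    have h1 : ¬ a' < a := fun hlt => h' a' hlt (isOne_of_up ha'.le hup)
    have h2 : ¬ a < a' := fun hlt => h.2.2.2 a' hlt hup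
    obtain rfl : a' = a := by omega
    exact hup

/-- The up arrows below the diagonal are determined by the `1`s. A left arrow of one tableau there
makes its cell a `0`, which in the other tableau can only be caused by a left arrow weakly to the
right. Applying this both ways puts the two left arrows in the same cell, as a row has at most one.
-/
theorem toPermutation_injective {T U : AlternativeTableau} {hT : T.IsSymmetric}
    {hU : U.IsSymmetric} (h : T.toPermutation hT = U.toPermutation hU) : T = U := by
  have hone : ∀ a b, T.IsOne a b ↔ U.IsOne a b := fun a b => by
    rw [← mem_ones_toPermutation (hT := hT), h, mem_ones_toPermutation]
  have hup : ∀ a b, b < a → (T.entry (a, b) = some Arrow.up ↔ U.entry (a, b) = some Arrow.up) :=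
    fun a b hab => by simp only [hT.entry_eq_up_iff hab, hU.entry_eq_up_iff hab, hone]
  have key : ∀ {T U : AlternativeTableau}, T.IsSymmetric → U.IsSymmetric →
      T.diagram = U.diagram → (∀ a b, T.IsOne a b ↔ U.IsOne a b) →
      (∀ a b, b < a → (T.entry (a, b) = some Arrow.up ↔ U.entry (a, b) = some Arrow.up)) →
      ∀ a b, b < a → T.entry (a, b) = some Arrow.left →
        ∃ b', b ≤ b' ∧ b' < a ∧ U.entry (a, b') = some Arrow.left := by
    intro T U hT hU hd hone hup a b hab h
    have hmem := mem_shape_of_entry (h ▸ Option.some_ne_none _)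
    have hnot : ¬ U.IsOne a b := fun h' => ((hone a b).2 h').2.2.1 b le_rfl h
    rcases not_isOne hab.le (hd ▸ hmem) hnot with ⟨b', hb', h'⟩ | ⟨a', ha', h'⟩
    · refine ⟨b', hb', ?_, h'⟩
      by_contra! hle
      rcases hle.lt_or_eq with hlt | rfl
      · rw [← hU.entry_eq_up, ← hup b' a hlt, hT.entry_eq_up] at h'
        simp [T.left_condition a b' h' b (by omega)] at h
      · simp [hU.entry_diag] at h'
    · rw [← hup a' b (by omega)] at h'
      simp [T.up_condition a' b h' a ha'] at h
  have hd : T.diagram = U.diagram :=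
    Diagram.eq_of_fold_eq hT.1 hU.1 (congrArg TypeBPermutationTableau.diagram h)
  have hleft : ∀ {T U : AlternativeTableau}, T.IsSymmetric → U.IsSymmetric →
      T.diagram = U.diagram → (∀ a b, T.IsOne a b ↔ U.IsOne a b) →
      (∀ a b, b < a → (T.entry (a, b) = some Arrow.up ↔ U.entry (a, b) = some Arrow.up)) →
      ∀ a b, b < a → T.entry (a, b) = some Arrow.left → U.entry (a, b) = some Arrow.left := by
    intro T U hT hU hd hone hup a b hab h
    obtain ⟨b', h1, h2, h3⟩ := key hT hU hd hone hup a b hab h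
    obtain ⟨b'', h4, h5, h6⟩ := key hU hT hd.symm (fun a b => (hone a b).symm)
      (fun a b hab => (hup a b hab).symm) a b' h2 h3
    have hb : ¬ b < b'' := fun hlt => by simp [T.left_condition a b'' h6 b hlt] at h
    obtain rfl : b' = b := by omega
    exact h3
  have hlow : ∀ a b, b < a → T.entry (a, b) = U.entry (a, b) := fun a b hab => by
    have h1 := hup a b hab
    have h2 := hleft hT hU hd hone hup a b hab
    have h3 := hleft hU hT hd.symm (fun a b => (hone a b).symm)
      (fun a b hab => (hup a b hab).symm) a b hab
    rcases hT' : T.entry (a, b) with - | (- | -) <;> rcases hU' : U.entry (a, b) with - | (- | -) <;>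
      simp_all
  refine ext_entry hd fun a b => ?_
  rcases lt_trichotomy a b with hab | rfl | hab
  · rw [hT.2 b a, hU.2 b a, hlow b a hab]
  · rw [hT.entry_diag, hU.entry_diag]
  · exact hlow a b hab

end AlternativeTableau

namespace TypeBPermutationTableau

/-- A `0` that has a `1` above it or lies in a diagonal cell. -/
def IsRestricted (S : TypeBPermutationTableau) (a b : ℕ) : Prop :=
  (a, b) ∈ S.diagram.shiftedCells ∧ (a, b) ∉ S.ones ∧ ((∃ a' < a, (a', b) ∈ S.ones) ∨ a = b)

theorem IsRestricted.left_notMem {S : TypeBPermutationTableau} {a b : ℕ}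
    (h : S.IsRestricted a b) {b' : ℕ} (hb : b' < b) : (a, b') ∉ S.ones := by
  obtain ⟨h1, h2, h3 | rfl⟩ := h
  · exact fun h' => S.zero_condition a b h1 h2 ⟨h3, b', hb, h'⟩
  · exact S.diagonal_condition a (Diagram.diag_mem_shiftedCells.1 h1) h2 b' hb

/-- A `1` that is the topmost one of its column. -/
def IsTopOne (S : TypeBPermutationTableau) (a b : ℕ) : Prop :=
  (a, b) ∈ S.ones ∧ ∀ a' < a, (a', b) ∉ S.ones

/-- A restricted `0` that is the rightmost one of its row. -/
def IsLastRestricted (S : TypeBPermutationTableau) (a b : ℕ) : Prop :=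
  S.IsRestricted a b ∧ ∀ b', b < b' → ¬ S.IsRestricted a b'

open scoped Classical in
/-- The arrows below the main diagonal of the symmetric alternative tableau that corresponds to a
type `B` permutation tableau. -/
noncomputable def lowerEntry (S : TypeBPermutationTableau) (a b : ℕ) : Option Arrow :=
  if S.IsTopOne a b then some Arrow.up
  else if S.IsLastRestricted a b then some Arrow.left else none

theorem lowerEntry_eq_up {S : TypeBPermutationTableau} {a b : ℕ} :
    S.lowerEntry a b = some Arrow.up ↔ S.IsTopOne a b := by
  unfold lowerEntry
  split_ifs <;> simp_all

theorem lowerEntry_eq_left {S : TypeBPermutationTableau} {a b : ℕ} :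
    S.lowerEntry a b = some Arrow.left ↔ S.IsLastRestricted a b := by
  have : S.IsLastRestricted a b → ¬ S.IsTopOne a b := fun h h' => h.1.2.1 h'.1
  unfold lowerEntry
  split_ifs <;> simp_all

theorem lowerEntry_eq_none {S : TypeBPermutationTableau} {a b : ℕ} :
    S.lowerEntry a b = none ↔ ¬ S.IsTopOne a b ∧ ¬ S.IsLastRestricted a b := by
  unfold lowerEntry
  split_ifs <;> simp_all

/-- The filling of the symmetric alternative tableau that corresponds to a type `B` permutation
tableau. -/
noncomputable def fullEntry (S : TypeBPermutationTableau) (c : ℕ × ℕ) : Option Arrow :=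
  if c.2 < c.1 then S.lowerEntry c.1 c.2
  else if c.1 < c.2 then (S.lowerEntry c.2 c.1).map Arrow.reflect else none

theorem fullEntry_of_lt {S : TypeBPermutationTableau} {a b : ℕ} (h : b < a) :
    S.fullEntry (a, b) = S.lowerEntry a b := if_pos h

theorem fullEntry_of_gt {S : TypeBPermutationTableau} {a b : ℕ} (h : a < b) :
    S.fullEntry (a, b) = (S.lowerEntry b a).map Arrow.reflect := by
  rw [fullEntry, if_neg (by simp only; omega), if_pos h]

theorem fullEntry_diag {S : TypeBPermutationTableau} (a : ℕ) : S.fullEntry (a, a) = none := by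
  simp [fullEntry]

theorem fullEntry_comm {S : TypeBPermutationTableau} (a b : ℕ) :
    S.fullEntry (b, a) = (S.fullEntry (a, b)).map Arrow.reflect := by
  rcases lt_trichotomy a b with h | rfl | h
  · rw [fullEntry_of_lt h, fullEntry_of_gt h]
    simp [Function.comp_def]
  · simp [fullEntry_diag]
  · rw [fullEntry_of_lt h, fullEntry_of_gt h]

theorem IsTopOne.isRestricted_diag {S : TypeBPermutationTableau} {a b : ℕ} (h : S.IsTopOne a b)
    (hab : b < a) : S.IsRestricted b b :=
  ⟨Diagram.diag_mem_shiftedCells.2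
    (Diagram.snd_lt_cols_of_mem_shiftedCells (S.ones_subset _ h.1)), h.2 b hab, Or.inr rfl⟩

theorem IsRestricted.lowerEntry_eq_none {S : TypeBPermutationTableau} {a b b' : ℕ}
    (h : S.IsRestricted a b) (hb : b' < b) : S.lowerEntry a b' = none :=
  TypeBPermutationTableau.lowerEntry_eq_none.2
    ⟨fun h' => h.left_notMem hb h'.1, fun h' => h'.2 b hb h⟩

/-- For a left arrow to the right of the diagonal, column `a` has its topmost `1` below the
diagonal. So the diagonal cell `(a, a)` is a restricted `0`, and row `a` is empty to its left;
between it and the arrow, the mirrored cells lie above that topmost `1`. -/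
theorem fullEntry_left_condition {S : TypeBPermutationTableau} {a b b' : ℕ}
    (h : S.fullEntry (a, b) = some Arrow.left) (hb : b' < b) : S.fullEntry (a, b') = none := by
  rcases lt_trichotomy a b with hab | rfl | hab
  · rw [fullEntry_of_gt hab, Arrow.map_reflect_eq_left, lowerEntry_eq_up] at h
    rcases lt_trichotomy a b' with hab' | rfl | hab'
    · rw [fullEntry_of_gt hab', Option.map_eq_none_iff, lowerEntry_eq_none]
      refine ⟨fun h' => h.2 b' hb h'.1, fun h' => ?_⟩
      rcases h'.1.2.2 with ⟨c, hc, h''⟩ | rfl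
      · exact h.2 c (by omega) h''
      · exact lt_irrefl _ hab'
    · exact fullEntry_diag _
    · rw [fullEntry_of_lt hab']
      exact (h.isRestricted_diag hab).lowerEntry_eq_none hab'
  · simp [fullEntry_diag] at h
  · rw [fullEntry_of_lt hab, lowerEntry_eq_left] at h
    rw [fullEntry_of_lt (by omega)]
    exact h.1.lowerEntry_eq_none hb

theorem mem_shiftedCells_of_lowerEntry {S : TypeBPermutationTableau} {a b : ℕ}
    (h : S.lowerEntry a b ≠ none) : (a, b) ∈ S.diagram.shiftedCells := by
  by_contra hmem
  exact h (lowerEntry_eq_none.2 ⟨fun h' => hmem (S.ones_subset _ h'.1), fun h' => hmem h'.1.1⟩)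

/-- The symmetric alternative tableau that corresponds to a type `B` permutation tableau. -/
noncomputable def toAlternative (S : TypeBPermutationTableau) : AlternativeTableau where
  diagram := S.diagram.unfold
  entry := S.fullEntry
  entry_eq_none := by
    rintro ⟨a, b⟩ h
    by_contra h'
    refine h ?_
    rcases lt_trichotomy a b with hab | rfl | hab
    · rw [fullEntry_of_gt hab, Option.map_eq_none_iff] at h'
      rw [← Diagram.mem_unfold_comm, Diagram.mem_unfold_of_le hab.le]
      exact mem_shiftedCells_of_lowerEntry h'
    · exact absurd (fullEntry_diag a) h'
    · rw [fullEntry_of_lt hab] at h'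
      rw [Diagram.mem_unfold_of_le hab.le]
      exact mem_shiftedCells_of_lowerEntry h'
  left_condition := fun a b h b' hb => fullEntry_left_condition h hb
  up_condition := fun a b h a' ha => by
    rw [fullEntry_comm, Arrow.map_reflect_eq_up] at h
    rw [fullEntry_comm, fullEntry_left_condition h ha, Option.map_none]

theorem toAlternative_mem {n : ℕ} {S : TypeBPermutationTableau}
    (h : S ∈ typeBPermutationTableaux n) :
    S.toAlternative ∈ symmetricAlternativeTableaux (2 * n) :=
  mem_symmetricAlternativeTableaux.2 ⟨h, h, fun _ _ => Diagram.mem_unfold_comm, fullEntry_comm⟩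

theorem exists_isTopOne {S : TypeBPermutationTableau} {b : ℕ} (hb : b < S.diagram.cols) :
    ∃ a, S.IsTopOne a b := by
  classical
  have hex := S.exists_one b hb
  exact ⟨Nat.find hex, Nat.find_spec hex, fun a ha => Nat.find_min hex ha⟩

theorem IsRestricted.exists_isLastRestricted {S : TypeBPermutationTableau} {a b : ℕ}
    (h : S.IsRestricted a b) : ∃ b', b ≤ b' ∧ S.IsLastRestricted a b' := by
  classical
  have hle : ∀ {b}, S.IsRestricted a b → b ≤ a := fun h => Diagram.le_of_mem_shiftedCells h.1
  refine ⟨Nat.findGreatest (S.IsRestricted a) a, Nat.le_findGreatest (hle h) h,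
    Nat.findGreatest_spec (hle h) h, fun b' hb' h' => ?_⟩
  exact (Nat.le_findGreatest (hle h') h').not_gt hb'

/-- A `0` not above the up arrow of its column is restricted, so the rightmost restricted `0` of its
row is weakly to its right and yields a left arrow there or beyond the diagonal. Conversely, no
restricted `0` has a `1` to its left. -/
theorem isOne_toAlternative {S : TypeBPermutationTableau} {a b : ℕ} :
    S.toAlternative.IsOne a b ↔ (a, b) ∈ S.ones := by
  constructor
  · rintro ⟨hab, hmem, h1, h2⟩
    by_contra h
    have hmem' : (a, b) ∈ S.diagram.shiftedCells := (Diagram.mem_unfold_of_le hab).1 hmem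
    have hup : ∀ a', b < a' → S.IsTopOne a' b → a' ≤ a := fun a' ha' h' => by
      by_contra! hlt
      exact h2 a' hlt ((fullEntry_of_lt ha').trans (lowerEntry_eq_up.2 h'))
    obtain ⟨a', ha'⟩ := exists_isTopOne (Diagram.snd_lt_cols_of_mem_shiftedCells hmem')
    have hba' : b ≤ a' := Diagram.le_of_mem_shiftedCells (S.ones_subset _ ha'.1)
    have hres : S.IsRestricted a b := by
      refine ⟨hmem', h, ?_⟩
      by_contra! h'
      have h3 : ¬ a' < a := fun hlt => h'.1 a' hlt ha'.1
      have h4 := hup a' (by omega) ha'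
      obtain rfl : a' = a := by omega
      exact h ha'.1
    obtain ⟨b', hb', hlast⟩ := hres.exists_isLastRestricted
    rcases (Diagram.le_of_mem_shiftedCells hlast.1.1).lt_or_eq with hlt | rfl
    · exact h1 b' hb' ((fullEntry_of_lt hlt).trans (lowerEntry_eq_left.2 hlast))
    -- On the diagonal no arrow is placed; the up arrow on the topmost `1` of column `b'` is
    -- mirrored into this row instead.
    · obtain ⟨c, hc⟩ := exists_isTopOne (Diagram.snd_lt_cols_of_mem_shiftedCells hlast.1.1)
      have hle := Diagram.le_of_mem_shiftedCells (S.ones_subset _ hc.1)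
      have hlt : b' < c := by
        refine lt_of_le_of_ne hle ?_
        rintro rfl
        exact hlast.1.2.1 hc.1
      refine h1 c (by omega) ((fullEntry_of_gt hlt).trans ?_)
      rw [Arrow.map_reflect_eq_left]
      exact lowerEntry_eq_up.2 hc
  · intro h
    have hmem := S.ones_subset _ h
    have hab := Diagram.le_of_mem_shiftedCells hmem
    refine ⟨hab, (Diagram.mem_unfold_of_le hab).2 hmem, fun b' hb' h' => ?_, fun a' ha' h' => ?_⟩
    · change S.fullEntry (a, b') = _ at h'
      have key : ∀ c, S.IsRestricted a c → b ≤ c → False := fun c hc hbc => by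
        rcases hbc.lt_or_eq with hlt | rfl
        · exact hc.left_notMem hlt h
        · exact hc.2.1 h
      rcases lt_trichotomy a b' with hlt | rfl | hlt
      · rw [fullEntry_of_gt hlt, Arrow.map_reflect_eq_left, lowerEntry_eq_up] at h'
        exact key a (h'.isRestricted_diag hlt) hab
      · simp [fullEntry_diag] at h'
      · rw [fullEntry_of_lt hlt, lowerEntry_eq_left] at h'
        exact key b' h'.1 hb'
    · change S.fullEntry (a', b) = _ at h'
      rw [fullEntry_of_lt (by omega), lowerEntry_eq_up] at h'
      exact h'.2 a ha' h

theorem toPermutation_toAlternative (S : TypeBPermutationTableau)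
    (h : S.toAlternative.IsSymmetric) : S.toAlternative.toPermutation h = S :=
  ext_ones S.diagram.fold_unfold fun _ _ =>
    AlternativeTableau.mem_ones_toPermutation.trans isOne_toAlternative

end TypeBPermutationTableau

/-! ### Transfer of the corner counts and the final evaluation -/

/-- The number of pairs of an object of a finite family and of one of finitely many items on it. -/
theorem ncard_pairs {ι α β : Type*} [Fintype ι] {φ : ι → α} (hφ : Function.Injective φ)
    {X : Set α} (hX : Set.range φ = X) {R : α → β → Prop} (hfin : ∀ i, {y | R (φ i) y}.Finite) :
    {p : α × β | p.1 ∈ X ∧ R p.1 p.2}.ncard = ∑ i, {y | R (φ i) y}.ncard := by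
  subst hX
  have : ∀ i, Finite {y | R (φ i) y} := fun i => (hfin i).to_subtype
  have h : {p : α × β | p.1 ∈ Set.range φ ∧ R p.1 p.2} =
      Set.range fun x : Σ i, {y | R (φ i) y} => (φ x.1, x.2.1) := by
    ext ⟨a, b⟩
    constructor
    · rintro ⟨⟨i, rfl⟩, h⟩
      exact ⟨⟨i, b, h⟩, rfl⟩
    · rintro ⟨⟨i, y, hy⟩, h⟩
      obtain ⟨rfl, rfl⟩ := Prod.mk.inj h
      exact ⟨⟨i, rfl⟩, hy⟩
  rw [h, ← Nat.card_coe_set_eq, Nat.card_range_of_injective, Nat.card_sigma]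
  · simp only [Nat.card_coe_set_eq]
  · rintro ⟨i, y, hy⟩ ⟨j, z, hz⟩ h
    obtain ⟨h1, h2⟩ := Prod.mk.inj h
    obtain rfl := hφ h1
    simp only at h2
    subst h2
    rfl

theorem range_toPermutation (n : ℕ) :
    (Set.range fun T : symmetricAlternativeTableaux (2 * n) => T.1.toPermutation T.2.1) =
      typeBPermutationTableaux n := by
  ext S
  constructor
  · rintro ⟨T, rfl⟩
    exact AlternativeTableau.toPermutation_mem T.2
  · intro h
    exact ⟨⟨S.toAlternative, S.toAlternative_mem h⟩, S.toPermutation_toAlternative _⟩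

theorem range_toTreeLike (n : ℕ) :
    (Set.range fun T : symmetricAlternativeTableaux (2 * n) => T.1.toTreeLike T.2.1) =
      symmetricTreeLikeTableaux (2 * n + 1) := by
  ext S
  constructor
  · rintro ⟨T, rfl⟩
    exact AlternativeTableau.toTreeLike_mem T.2
  · intro h
    obtain ⟨T, hT, rfl⟩ := AlternativeTableau.exists_toTreeLike h
    exact ⟨⟨T, hT⟩, rfl⟩

theorem Diagram.finite_setOf_isCorner (D : Diagram) : {c | D.IsCorner c}.Finite :=
  D.shape.cells.finite_toSet.subset fun _ hc => hc.1

theorem ncard_typeBCorners (n : ℕ) :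
    ((typeBCorners (typeBPermutationTableaux n)).ncard : ℚ) =
      weightedSum (fun D => D.lowerCorners) n 1 := by
  have h : ∀ T : symmetricAlternativeTableaux (2 * n),
      {c | (T.1.toPermutation T.2.1).diagram.IsShiftedCorner c} =
        {c | T.1.diagram.IsCorner c ∧ c.2 < c.1} := fun T =>
    Set.ext fun c => T.1.diagram.isShiftedCorner_fold c
  rw [typeBCorners, ncard_pairs (R := fun T c => T.diagram.IsShiftedCorner c)
    (fun T U h => Subtype.ext (AlternativeTableau.toPermutation_injective h))
    (range_toPermutation n) (fun T => (h T).symm ▸ T.1.diagram.finite_isCorner _),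
    weightedSum_one, Nat.cast_sum]
  exact Finset.sum_congr rfl fun T _ => by rw [h T]; rfl

theorem ncard_alternativeCorners (n : ℕ) :
    ((alternativeCorners (symmetricAlternativeTableaux (2 * n))).ncard : ℚ) =
      2 * weightedSum (fun D => D.lowerCorners) n 1 +
        weightedSum (fun D => D.diagonalCorners) n 1 := by
  rw [alternativeCorners, ncard_pairs (ι := symmetricAlternativeTableaux (2 * n)) (φ := Subtype.val)
    (R := fun T c => T.diagram.IsCorner c) Subtype.val_injective Subtype.range_val (fun T => T.1.diagram.finite_setOf_isCorner),
    weightedSum_one, weightedSum_one, Nat.cast_sum, Finset.mul_sum, ← Finset.sum_add_distrib]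
  refine Finset.sum_congr rfl fun T _ => ?_
  rw [Diagram.ncard_isCorner T.2.1.1]
  push_cast
  rfl

open scoped Classical in
theorem ncard_treeLikeCorners (n : ℕ) :
    ((treeLikeCorners (symmetricTreeLikeTableaux (2 * (n + 1) + 1))).ncard : ℚ) =
      2 * weightedSum (fun D => D.lowerCorners) (n + 1) 1 +
        weightedSum (fun D => D.diagonalCorners) (n + 1) 1 +
        2 * weightedSum (fun D => if D.HasEmptyLastRow then 1 else 0) (n + 1) 1 := by
  rw [treeLikeCorners, ncard_pairs (R := fun T c => T.diagram.IsCorner c)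
    (fun T U h => Subtype.ext (AlternativeTableau.toTreeLike_injective h))
    (range_toTreeLike (n + 1))
    (fun T => (T.1.toTreeLike T.2.1).diagram.finite_setOf_isCorner),
    weightedSum_one, weightedSum_one, weightedSum_one, Nat.cast_sum, Finset.mul_sum,
    Finset.mul_sum, ← Finset.sum_add_distrib, ← Finset.sum_add_distrib]
  refine Finset.sum_congr rfl fun T _ => ?_
  have hrows := (mem_symmetricAlternativeTableaux.1 T.2).1
  rw [Diagram.ncard_isCorner (AlternativeTableau.toTreeLike_mem T.2).1.1]
  change ((2 * T.1.diagram.addLine.lowerCorners + T.1.diagram.addLine.diagonalCorners : ℕ) : ℚ) = _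
  -- The old diagram has `n + 1` rows, so the added line creates no diagonal corner.
  rw [Diagram.lowerCorners_addLine, Diagram.diagonalCorners_addLine,
    if_neg (c := T.1.diagram.rows = 0 ∧ _) (by omega)]
  push_cast
  ring

end CornerCount

theorem mainTheorem2 (n : ℕ) (hn : 1 ≤ n) :
    ((typeBPermutationTableaux n).Finite ∧
      ((typeBCorners (typeBPermutationTableaux n)).ncard : ℚ) =
        if n = 1 then 0
        else 2 ^ (n - 1) * (Nat.factorial (n - 1) : ℚ) * ((4 * (n : ℚ) ^ 2 + 7 * n - 12) / 12)) ∧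
    ((symmetricAlternativeTableaux (2 * n)).Finite ∧
      ((alternativeCorners (symmetricAlternativeTableaux (2 * n))).ncard : ℚ) =
        if n = 1 then 1
        else 2 ^ n * (Nat.factorial (n - 1) : ℚ) * ((4 * (n : ℚ) ^ 2 + 13 * n - 12) / 12)) ∧
    ((symmetricTreeLikeTableaux (2 * n + 1)).Finite ∧
      ((treeLikeCorners (symmetricTreeLikeTableaux (2 * n + 1))).ncard : ℚ) =
        if n = 1 then 3
        else 2 ^ n * (Nat.factorial n : ℚ) * ((4 * (n : ℚ) + 13) / 12)) := by
  classical
  refine ⟨⟨range_toPermutation n ▸ Set.finite_range _, ?_⟩,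
    ⟨symmetricAlternativeTableaux_finite n, ?_⟩, ⟨range_toTreeLike n ▸ Set.finite_range _, ?_⟩⟩
  all_goals obtain ⟨m, rfl⟩ := Nat.exists_eq_add_of_le' hn
  · rw [ncard_typeBCorners]
    rcases m with - | m
    · simp [weightedSum_lowerCorners_one]
    · rw [weightedSum_lowerCorners, weightedSum_const_one_one, if_neg (by omega),
        Nat.add_sub_cancel, Nat.factorial_succ, pow_succ]
      push_cast
      ring
  · have hd := weightedSum_diagonalCorners_succ m 1
    rw [weightedSum_const_one_one] at hd
    rw [ncard_alternativeCorners]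
    rcases m with - | m
    · simp at hd
      simp [weightedSum_lowerCorners_one, hd]
    · rw [weightedSum_lowerCorners, weightedSum_const_one_one, if_neg (by omega),
        Nat.add_sub_cancel]
      simp only [Nat.factorial_succ, pow_succ] at hd ⊢
      push_cast at hd ⊢
      -- The diagonal corners contribute half the number of tableaux.
      linear_combination hd / 2
  · have hd := weightedSum_diagonalCorners_succ m 1
    rw [weightedSum_const_one_one] at hd
    rw [ncard_treeLikeCorners, weightedSum_hasEmptyLastRow_succ, weightedSum_const_one_one]
    rcases m with - | m
    · simp at hd
      simp [weightedSum_lowerCorners_one, hd]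
      norm_num
    · rw [weightedSum_lowerCorners, weightedSum_const_one_one, if_neg (by omega)]
      simp only [Nat.factorial_succ, pow_succ] at hd ⊢
      push_cast at hd ⊢
      linear_combination hd / 2
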